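/- Let $\mathcal C$ be a semi-abelian category (pointed, with finite coproducts, protomodular and Barr-exact) satisfying the condition "Huq = Smith" (two equivalence relations on the same object commute in the sense of Smith as soon as their normalizations commute in the sense of Huq), and assume that $\mathcal C$ has enough regular projectives: every object is the codomain of a regular epimorphism with regular projective domain. For an internal groupoid $\mathbb G=(d,c\colon G_1\rightrightarrows G_0)$ with unit $e$, let $J(\mathbb G)$ be its normalization, i.e. the internal crossed module with $\partial = d\circ g\colon G\to G_0$, where $g\colon G\to G_1$ is the kernel of $c$, and with the action $\xi\colon G_0\flat G\to G$ determined by $g\circ\xi=[e,g]\circ j$, where $j\colon G_0\flat G\to G_0+G$ is the kernel of $[1,0]\colon G_0+G\to G_0$. For crossed modules $\mathbb H=(\partial\colon H\to H_0,\xi)$ and $\mathbb G=(\partial\colon G\to G_0,\xi)$ let $\mathcal B(\mathcal C)(\mathbb H,\mathbb G)$ be the groupoid of butterflies from $\mathbb H$ to $\mathbb G$: its objects are objects $E$ with morphisms $\kappa\colon H\to E$, $\iota\colon G\to E$, $\sigma\colon E\to H_0$, $\rho\colon E\to G_0$ such that $\sigma\kappa=\partial$, $\rho\iota=\partial$, $\rho\kappa=0$,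 $\iota=\ker\sigma$ and $\sigma=\operatorname{coker}\iota$, $\kappa\circ\xi\circ(\sigma\flat 1)=\chi_E\circ(1\flat\kappa)$ and $\iota\circ\xi\circ(\rho\flat 1)=\chi_E\circ(1\flat\iota)$, where $\chi_E\colon E\flat E\to E$ is the conjugation action; its morphisms are the morphisms $E\to E'$ of $\mathcal C$ commuting with $\kappa,\iota,\sigma,\rho$. Let $\mathrm{Grpd}(\mathcal C)(\mathbb X,\mathbb D)$ be the groupoid of internal functors $\mathbb X\to\mathbb D$ and internal natural transformations. Let $\mathbb C$ and $\mathbb D$ be internal groupoids in $\mathcal C$, let $s_0\colon X_0\to C_0$ be a regular epimorphism with $X_0$ regular projective, and let $\mathbb X=(d,c\colon X_1\rightrightarrows X_0)$ be the internal groupoid obtained by pulling back $\mathbb C$ along $s_0$: $X_1$, with $d,c\colon X_1\to X_0$ and $s_1\colon X_1\to C_1$, is the limit of $X_0\xrightarrow{s_0}C_0\xleftarrow{d}C_1\xrightarrow{c}C_0\xleftarrow{s_0}X_0$, with the groupoid structure inherited from $\mathbb C$. Then there is an equivalence of groupoids $$\mathcal B(\mathcal C)(J(\mathbb C),J(\mathbb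 D))\simeq \mathrm{Grpd}(\mathcal C)(\mathbb X,\mathbb D).$$ -/

import Mathlib

open CategoryTheory CategoryTheory.Limits

universe v u

-- keeps `X ⟶ Y` elaborating through the category structure itself
attribute [-instance] CategoryTheory.catToReflQuiver

namespace SemiAb

/-! ### Semi-abelian categories, the condition "Huq = Smith", regular projectives -/

section Context

variable (𝒞 : Type u) [Category.{v} 𝒞]

/-- The split short five lemma, which for a pointed category with finite limits is
protomodularity: in a morphism of split epimorphisms together with their kernels, the middle
component is an isomorphism as soon as the outer two are. -/
def SplitShortFive [HasZeroMorphisms 𝒞] : Prop :=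
  ∀ ⦃K A B K' A' B' : 𝒞⦄ (k : K ⟶ A) (p : A ⟶ B) (s : B ⟶ A)
    (k' : K' ⟶ A') (p' : A' ⟶ B') (s' : B' ⟶ A') (h : K ⟶ K') (f : A ⟶ A') (g : B ⟶ B')
    (w : k ≫ p = 0) (w' : k' ≫ p' = 0),
    Nonempty (IsLimit (KernelFork.ofι k w)) → Nonempty (IsLimit (KernelFork.ofι k' w')) →
    s ≫ p = 𝟙 B → s' ≫ p' = 𝟙 B' →
    k ≫ f = h ≫ k' → p ≫ g = f ≫ p' → s ≫ f = g ≫ s' →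
    IsIso h → IsIso g → IsIso f

/-- Semi-abelian categories: pointed, with finite coproducts, protomodular and exact in the sense
of Barr (regular, and every internal equivalence relation is a kernel pair). -/
class SemiAbelian [HasZeroMorphisms 𝒞] : Prop extends
    Regular 𝒞, HasZeroObject 𝒞 where
  hasFiniteCoproducts : HasFiniteCoproducts 𝒞
  splitShortFive : SplitShortFive 𝒞
  effective : ∀ ⦃R X : 𝒞⦄ (r₁ r₂ : R ⟶ X), IsEquivalenceRelation r₁ r₂ →
    ∃ (Y : 𝒞) (f : X ⟶ Y), IsKernelPair f r₁ r₂

attribute [instance] SemiAbelian.hasFiniteCoproducts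

variable {𝒞}

/-- Two morphisms with common codomain cooperate (for subobjects: commute in the sense of Huq). -/
def Cooperate [HasZeroMorphisms 𝒞] [HasBinaryProducts 𝒞] {G H E : 𝒞}
    (g : G ⟶ E) (h : H ⟶ E) : Prop :=
  ∃ φ : G ⨯ H ⟶ E, prod.lift (𝟙 G) 0 ≫ φ = g ∧ prod.lift 0 (𝟙 H) ≫ φ = h

/-- Two equivalence relations `R`, `S` on `E` commute in the sense of Smith: there is
`Φ : R ×_E S ⟶ E` with `Φ(x, y, y) = x` and `Φ(y, y, z) = z`. -/
def SmithCommute [HasPullbacks 𝒞] {E R S : 𝒞} {r₁ r₂ : R ⟶ E} {s₁ s₂ : S ⟶ E}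
    (hR : EquivalenceRelation r₁ r₂) (hS : EquivalenceRelation s₁ s₂) : Prop :=
  ∃ Φ : pullback r₂ s₁ ⟶ E,
    pullback.lift (𝟙 R) (r₂ ≫ hS.r) (by simp) ≫ Φ = r₁ ∧
    pullback.lift (s₁ ≫ hR.r) (𝟙 S) (by simp) ≫ Φ = s₂

variable (𝒞)

/-- "Huq = Smith": two equivalence relations commute as soon as their normalizations
(the kernel of the second leg followed by the first leg) cooperate. -/
class HuqSmith [HasZeroMorphisms 𝒞] [HasFiniteLimits 𝒞] : Prop where
  smithCommute : ∀ ⦃E R S : 𝒞⦄ ⦃r₁ r₂ : R ⟶ E⦄ ⦃s₁ s₂ : S ⟶ E⦄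
    (hR : EquivalenceRelation r₁ r₂) (hS : EquivalenceRelation s₁ s₂),
    Cooperate (kernel.ι r₂ ≫ r₁) (kernel.ι s₂ ≫ s₁) → SmithCommute hR hS

variable {𝒞}

/-- Regular projective objects: morphisms out of `P` lift along regular epimorphisms. -/
def RegularProjective (P : 𝒞) : Prop :=
  ∀ ⦃A B : 𝒞⦄ (f : A ⟶ B), IsRegularEpi f → ∀ g : P ⟶ B, ∃ h : P ⟶ A, h ≫ f = g

variable (𝒞)

/-- Every object is a regular quotient of a regular projective object. -/
class EnoughRegularProjectives : Prop where
  exists_cover : ∀ X : 𝒞, ∃ (P : 𝒞) (p : P ⟶ X), RegularProjective P ∧ IsRegularEpi p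

end Context

/-! ### Internal groupoids, functors and natural transformations -/

section Groupoids

attribute [local simp] pullback.lift_fst pullback.lift_snd pullback.lift_fst_assoc
  pullback.lift_snd_assoc

/-- Internal groupoids. `d` is the domain, `c` the codomain, and `m` composes in diagrammatic
order, so that it is defined on the pullback of `c` along `d`. Associativity is stated on
generalized elements. -/
structure IntGroupoid (𝒞 : Type u) [Category.{v} 𝒞] [HasPullbacks 𝒞] where
  obj : 𝒞
  arr : 𝒞
  d : arr ⟶ obj
  c : arr ⟶ obj
  e : obj ⟶ arr
  m : pullback c d ⟶ arr
  i : arr ⟶ arr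
  e_d : e ≫ d = 𝟙 obj
  e_c : e ≫ c = 𝟙 obj
  m_d : m ≫ d = pullback.fst c d ≫ d
  m_c : m ≫ c = pullback.snd c d ≫ c
  i_d : i ≫ d = c
  i_c : i ≫ c = d
  id_m : pullback.lift (d ≫ e) (𝟙 arr) (by simp [e_c]) ≫ m = 𝟙 arr
  m_id : pullback.lift (𝟙 arr) (c ≫ e) (by simp [e_d]) ≫ m = 𝟙 arr
  assoc : ∀ ⦃T : 𝒞⦄ (f g h : T ⟶ arr) (hfg : f ≫ c = g ≫ d) (hgh : g ≫ c = h ≫ d),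
    pullback.lift (pullback.lift f g hfg ≫ m) h (by simp [m_c, hgh]) ≫ m =
      pullback.lift f (pullback.lift g h hgh ≫ m) (by simp [m_d, hfg]) ≫ m
  m_inv : pullback.lift (𝟙 arr) i (by simp [i_d]) ≫ m = d ≫ e
  inv_m : pullback.lift i (𝟙 arr) (by simp [i_c]) ≫ m = c ≫ e

variable {𝒞 : Type u} [Category.{v} 𝒞] [HasPullbacks 𝒞]

namespace IntGroupoid

variable (G : IntGroupoid 𝒞)

/-- Composition of generalized arrows, in diagrammatic order. -/
noncomputable def comp {T : 𝒞} (f g : T ⟶ G.arr) (h : f ≫ G.c = g ≫ G.d) : T ⟶ G.arr :=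
  pullback.lift f g h ≫ G.m

lemma comp_d {T : 𝒞} (f g : T ⟶ G.arr) (h : f ≫ G.c = g ≫ G.d) :
    G.comp f g h ≫ G.d = f ≫ G.d := by
  simp [comp, G.m_d]

lemma comp_c {T : 𝒞} (f g : T ⟶ G.arr) (h : f ≫ G.c = g ≫ G.d) :
    G.comp f g h ≫ G.c = g ≫ G.c := by
  simp [comp, G.m_c]

lemma precomp {S T : 𝒞} (t : S ⟶ T) (f g : T ⟶ G.arr) (h : f ≫ G.c = g ≫ G.d) :
    t ≫ G.comp f g h = G.comp (t ≫ f) (t ≫ g) (by simp [h]) := by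
  unfold comp
  rw [← Category.assoc]
  congr 1
  apply pullback.hom_ext <;> simp

lemma comp_congr {T : 𝒞} {f f' g g' : T ⟶ G.arr} (hf : f = f') (hg : g = g')
    (h : f ≫ G.c = g ≫ G.d) :
    G.comp f g h = G.comp f' g' (by rw [← hf, ← hg, h]) := by
  subst hf hg
  rfl

lemma comp_assoc {T : 𝒞} (f g h : T ⟶ G.arr) (hfg : f ≫ G.c = g ≫ G.d)
    (hgh : g ≫ G.c = h ≫ G.d) :
    G.comp (G.comp f g hfg) h (by rw [G.comp_c, hgh]) =
      G.comp f (G.comp g h hgh) (by rw [G.comp_d, hfg]) :=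
  G.assoc f g h hfg hgh

lemma id_comp {T : 𝒞} (x : T ⟶ G.obj) (f : T ⟶ G.arr) (h : (x ≫ G.e) ≫ G.c = f ≫ G.d) :
    G.comp (x ≫ G.e) f h = f := by
  have hx : x = f ≫ G.d := by rw [← h, Category.assoc, G.e_c, Category.comp_id]
  have h₁ : G.comp (G.d ≫ G.e) (𝟙 _) (by simp [G.e_c]) = 𝟙 _ := G.id_m
  have h₂ := G.precomp f (G.d ≫ G.e) (𝟙 _) (by simp [G.e_c])
  exact (G.comp_congr (by simp [hx]) (by simp) h).trans
    (h₂.symm.trans (by rw [h₁, Category.comp_id]))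

lemma comp_id {T : 𝒞} (f : T ⟶ G.arr) (x : T ⟶ G.obj) (h : f ≫ G.c = (x ≫ G.e) ≫ G.d) :
    G.comp f (x ≫ G.e) h = f := by
  have hx : x = f ≫ G.c := by rw [h, Category.assoc, G.e_d, Category.comp_id]
  have h₁ : G.comp (𝟙 _) (G.c ≫ G.e) (by simp [G.e_d]) = 𝟙 _ := G.m_id
  have h₂ := G.precomp f (𝟙 _) (G.c ≫ G.e) (by simp [G.e_d])
  exact (G.comp_congr (by simp) (by simp [hx]) h).trans
    (h₂.symm.trans (by rw [h₁, Category.comp_id]))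

lemma comp_inv {T : 𝒞} (f : T ⟶ G.arr) (h : f ≫ G.c = (f ≫ G.i) ≫ G.d) :
    G.comp f (f ≫ G.i) h = f ≫ G.d ≫ G.e := by
  have := G.precomp f (𝟙 _) G.i (by simp [G.i_d])
  rw [comp, G.m_inv] at this
  rw [this]
  exact G.comp_congr (by simp) rfl h

lemma inv_comp {T : 𝒞} (f : T ⟶ G.arr) (h : (f ≫ G.i) ≫ G.c = f ≫ G.d) :
    G.comp (f ≫ G.i) f h = f ≫ G.c ≫ G.e := by
  have := G.precomp f G.i (𝟙 _) (by simp [G.i_c])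
  rw [comp, G.inv_m] at this
  rw [this]
  exact G.comp_congr rfl (by simp) h

end IntGroupoid

/-- Internal functors between internal groupoids. -/
structure IntFunctor (G H : IntGroupoid 𝒞) where
  obj : G.obj ⟶ H.obj
  arr : G.arr ⟶ H.arr
  w_d : arr ≫ H.d = G.d ≫ obj
  w_c : arr ≫ H.c = G.c ≫ obj
  w_e : G.e ≫ arr = obj ≫ H.e
  w_m : G.m ≫ arr = pullback.lift (pullback.fst G.c G.d ≫ arr) (pullback.snd G.c G.d ≫ arr)
    (by simp only [Category.assoc, w_d, w_c]
        rw [← Category.assoc, pullback.condition, Category.assoc]) ≫ H.m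

/-- Internal natural transformations. -/
@[ext]
structure IntNatTrans {G H : IntGroupoid 𝒞} (P Q : IntFunctor G H) where
  app : G.obj ⟶ H.arr
  app_d : app ≫ H.d = P.obj
  app_c : app ≫ H.c = Q.obj
  naturality :
    pullback.lift P.arr (G.c ≫ app) (by rw [P.w_c, Category.assoc, app_d]) ≫ H.m =
      pullback.lift (G.d ≫ app) Q.arr (by rw [Q.w_d, Category.assoc, app_c]) ≫ H.m

/-- The category of internal functors `G ⟶ H` and internal natural transformations. -/
noncomputable instance IntFunctor.category (G H : IntGroupoid 𝒞) :
    Category (IntFunctor G H) where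
  Hom P Q := IntNatTrans P Q
  id P :=
    { app := P.obj ≫ H.e
      app_d := by simp [H.e_d]
      app_c := by simp [H.e_c]
      naturality := by
        have h₁ := H.comp_id P.arr (G.c ≫ P.obj) (by simp [H.e_d, P.w_c])
        have h₂ := H.id_comp (G.d ≫ P.obj) P.arr (by simp [H.e_c, P.w_d])
        simp only [Category.assoc] at h₁ h₂
        exact h₁.trans h₂.symm }
  comp {P Q R} α β :=
    { app := H.comp α.app β.app (by rw [α.app_c, β.app_d])
      app_d := by rw [H.comp_d, α.app_d]
      app_c := by rw [H.comp_c, β.app_c]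
      naturality := by
        have hα : H.comp P.arr (G.c ≫ α.app) _ = H.comp (G.d ≫ α.app) Q.arr _ := α.naturality
        have hβ : H.comp Q.arr (G.c ≫ β.app) _ = H.comp (G.d ≫ β.app) R.arr _ := β.naturality
        have hab : α.app ≫ H.c = β.app ≫ H.d := by rw [α.app_c, β.app_d]
        change H.comp P.arr (G.c ≫ H.comp α.app β.app hab) _ =
          H.comp (G.d ≫ H.comp α.app β.app hab) R.arr _
        rw [H.comp_congr rfl (H.precomp G.c α.app β.app hab),
          H.comp_congr (H.precomp G.d α.app β.app hab) rfl,
          ← H.comp_assoc P.arr (G.c ≫ α.app) (G.c ≫ β.app)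
            (by rw [P.w_c, Category.assoc, α.app_d]) (by simp [hab]),
          H.comp_congr hα rfl,
          H.comp_assoc (G.d ≫ α.app) Q.arr (G.c ≫ β.app)
            (by rw [Q.w_d, Category.assoc, α.app_c]) (by rw [Q.w_c, Category.assoc, β.app_d]),
          H.comp_congr rfl hβ,
          H.comp_assoc (G.d ≫ α.app) (G.d ≫ β.app) R.arr (by simp [hab])
            (by rw [R.w_d, Category.assoc, β.app_c])] }
  id_comp {P Q} α := IntNatTrans.ext (H.id_comp P.obj α.app (by simp [H.e_c, α.app_d]))
  comp_id {P Q} α := IntNatTrans.ext (H.comp_id α.app Q.obj (by simp [H.e_d, α.app_c]))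
  assoc {P Q R S} α β γ := IntNatTrans.ext (H.comp_assoc α.app β.app γ.app
    (by rw [α.app_c, β.app_d]) (by rw [β.app_c, γ.app_d]))

namespace IntGroupoid

variable (C : IntGroupoid 𝒞)

/-- `X₁`, with `d, c : X₁ ⟶ X₀` and `s₁ : X₁ ⟶ C₁`, is the limit of the diagram
`X₀ ⟶ C₀ ⟵ C₁ ⟶ C₀ ⟵ X₀` whose outer morphisms are `s₀` and whose inner morphisms are the
domain and the codomain of `C`. -/
structure IsRestriction {X₀ X₁ : 𝒞} (s₀ : X₀ ⟶ C.obj) (d c : X₁ ⟶ X₀) (s₁ : X₁ ⟶ C.arr) :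
    Prop where
  w_d : s₁ ≫ C.d = d ≫ s₀
  w_c : s₁ ≫ C.c = c ≫ s₀
  existsUnique : ∀ ⦃T : 𝒞⦄ (a b : T ⟶ X₀) (f : T ⟶ C.arr),
    f ≫ C.d = a ≫ s₀ → f ≫ C.c = b ≫ s₀ →
      ∃! t : T ⟶ X₁, t ≫ d = a ∧ t ≫ c = b ∧ t ≫ s₁ = f

namespace IsRestriction

variable {C} {X₀ X₁ : 𝒞} {s₀ : X₀ ⟶ C.obj} {d c : X₁ ⟶ X₀} {s₁ : X₁ ⟶ C.arr}
  (hX : C.IsRestriction s₀ d c s₁)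

/-- The morphism into the limit induced by a cone. -/
noncomputable def lift {T : 𝒞} (a b : T ⟶ X₀) (f : T ⟶ C.arr)
    (ha : f ≫ C.d = a ≫ s₀) (hb : f ≫ C.c = b ≫ s₀) : T ⟶ X₁ :=
  (hX.existsUnique a b f ha hb).choose

lemma lift_d {T : 𝒞} (a b : T ⟶ X₀) (f : T ⟶ C.arr)
    (ha : f ≫ C.d = a ≫ s₀) (hb : f ≫ C.c = b ≫ s₀) : hX.lift a b f ha hb ≫ d = a :=
  (hX.existsUnique a b f ha hb).choose_spec.1.1

lemma lift_c {T : 𝒞} (a b : T ⟶ X₀) (f : T ⟶ C.arr)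
    (ha : f ≫ C.d = a ≫ s₀) (hb : f ≫ C.c = b ≫ s₀) : hX.lift a b f ha hb ≫ c = b :=
  (hX.existsUnique a b f ha hb).choose_spec.1.2.1

lemma lift_s {T : 𝒞} (a b : T ⟶ X₀) (f : T ⟶ C.arr)
    (ha : f ≫ C.d = a ≫ s₀) (hb : f ≫ C.c = b ≫ s₀) : hX.lift a b f ha hb ≫ s₁ = f :=
  (hX.existsUnique a b f ha hb).choose_spec.1.2.2

lemma hom_ext (hX : C.IsRestriction s₀ d c s₁) {T : 𝒞} {f g : T ⟶ X₁}
    (h₁ : f ≫ d = g ≫ d) (h₂ : f ≫ c = g ≫ c) (h₃ : f ≫ s₁ = g ≫ s₁) : f = g :=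
  (hX.existsUnique (g ≫ d) (g ≫ c) (g ≫ s₁) (by simp [hX.w_d]) (by simp [hX.w_c])).unique
    ⟨h₁, h₂, h₃⟩ ⟨rfl, rfl, rfl⟩

lemma comp_condition (hX : C.IsRestriction s₀ d c s₁) {T : 𝒞} {f g : T ⟶ X₁}
    (h : f ≫ c = g ≫ d) : (f ≫ s₁) ≫ C.c = (g ≫ s₁) ≫ C.d := by
  rw [Category.assoc, Category.assoc, hX.w_c, hX.w_d, ← Category.assoc, h, Category.assoc]

/-- The composition inherited by the graph `d, c : X₁ ⟶ X₀`. -/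
noncomputable def mul : pullback c d ⟶ X₁ :=
  hX.lift (pullback.fst c d ≫ d) (pullback.snd c d ≫ c)
    (C.comp (pullback.fst c d ≫ s₁) (pullback.snd c d ≫ s₁)
      (hX.comp_condition pullback.condition))
    (by rw [C.comp_d]; simp [hX.w_d]) (by rw [C.comp_c]; simp [hX.w_c])

lemma mul_s : hX.mul ≫ s₁ = C.comp (pullback.fst c d ≫ s₁) (pullback.snd c d ≫ s₁)
    (hX.comp_condition pullback.condition) :=
  hX.lift_s _ _ _ _ _

lemma lift_mul_d {T : 𝒞} (f g : T ⟶ X₁) (h : f ≫ c = g ≫ d) :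
    pullback.lift f g h ≫ hX.mul ≫ d = f ≫ d := by
  simp [mul, lift_d]

lemma lift_mul_c {T : 𝒞} (f g : T ⟶ X₁) (h : f ≫ c = g ≫ d) :
    pullback.lift f g h ≫ hX.mul ≫ c = g ≫ c := by
  simp [mul, lift_c]

lemma lift_mul_s {T : 𝒞} (f g : T ⟶ X₁) (h : f ≫ c = g ≫ d) :
    pullback.lift f g h ≫ hX.mul ≫ s₁ = C.comp (f ≫ s₁) (g ≫ s₁) (hX.comp_condition h) := by
  rw [mul, lift_s, C.precomp]
  exact C.comp_congr (by simp) (by simp) _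

/-- The groupoid structure on the graph `d, c : X₁ ⟶ X₀` inherited from `C`. -/
noncomputable def groupoid : IntGroupoid 𝒞 where
  obj := X₀
  arr := X₁
  d := d
  c := c
  e := hX.lift (𝟙 X₀) (𝟙 X₀) (s₀ ≫ C.e) (by simp [C.e_d]) (by simp [C.e_c])
  m := hX.mul
  i := hX.lift c d (s₁ ≫ C.i) (by simp [C.i_d, hX.w_c]) (by simp [C.i_c, hX.w_d])
  e_d := hX.lift_d _ _ _ _ _
  e_c := hX.lift_c _ _ _ _ _
  m_d := hX.lift_d _ _ _ _ _
  m_c := hX.lift_c _ _ _ _ _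
  i_d := hX.lift_d _ _ _ _ _
  i_c := hX.lift_c _ _ _ _ _
  id_m := by
    apply hX.hom_ext
    · rw [Category.assoc, lift_mul_d]; simp [lift_d]
    · rw [Category.assoc, lift_mul_c]
    · rw [Category.assoc, lift_mul_s]
      have h := C.id_comp (d ≫ s₀) s₁ (by simp [C.e_c, hX.w_d])
      exact (C.comp_congr (by simp only [Category.assoc, lift_s]) (Category.id_comp _) _).trans
        (h.trans (Category.id_comp _).symm)
  m_id := by
    apply hX.hom_ext
    · rw [Category.assoc, lift_mul_d]
    · rw [Category.assoc, lift_mul_c]; simp [lift_c]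
    · rw [Category.assoc, lift_mul_s]
      have h := C.comp_id s₁ (c ≫ s₀) (by simp [C.e_d, hX.w_c])
      exact (C.comp_congr (Category.id_comp _) (by simp only [Category.assoc, lift_s]) _).trans
        (h.trans (Category.id_comp _).symm)
  assoc T f g h hfg hgh := by
    apply hX.hom_ext
    · simp only [Category.assoc, lift_mul_d]
    · simp only [Category.assoc, lift_mul_c]
    · simp only [Category.assoc, lift_mul_s]
      exact C.comp_assoc _ _ _ _ _
  m_inv := by
    apply hX.hom_ext
    · simp only [Category.assoc, lift_mul_d, lift_d]; simp
    · simp only [Category.assoc, lift_mul_c, lift_c]; simp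
    · simp only [Category.assoc, lift_mul_s, lift_s]
      rw [C.comp_congr (Category.id_comp s₁) rfl, C.comp_inv s₁ (by simp [C.i_d]),
        ← Category.assoc, hX.w_d, Category.assoc]
  inv_m := by
    apply hX.hom_ext
    · simp only [Category.assoc, lift_mul_d, lift_d]; simp
    · simp only [Category.assoc, lift_mul_c, lift_c]; simp
    · simp only [Category.assoc, lift_mul_s, lift_s]
      rw [C.comp_congr rfl (Category.id_comp s₁), C.inv_comp s₁ (by simp [C.i_c]),
        ← Category.assoc, hX.w_c, Category.assoc]

/-- The internal functor `(s₁, s₀)` from the restricted groupoid to `C`. -/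
noncomputable def functor : IntFunctor hX.groupoid C where
  obj := s₀
  arr := s₁
  w_d := hX.w_d
  w_c := hX.w_c
  w_e := hX.lift_s (𝟙 X₀) (𝟙 X₀) (s₀ ≫ C.e) (by simp [C.e_d]) (by simp [C.e_c])
  w_m := hX.mul_s

end IsRestriction

end IntGroupoid

end Groupoids

/-! ### Internal actions and crossed modules -/

section CrossedModules

attribute [local simp] pullback.lift_fst pullback.lift_snd pullback.lift_fst_assoc
  pullback.lift_snd_assoc coprod.inl_desc coprod.inr_desc coprod.inl_desc_assoc
  coprod.inr_desc_assoc coprod.inl_map coprod.inr_map coprod.inl_map_assoc coprod.inr_map_assoc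

variable {𝒞 : Type u} [Category.{v} 𝒞] [HasZeroMorphisms 𝒞] [HasKernels 𝒞]
  [HasBinaryCoproducts 𝒞]

/-- The object `B ♭ A`, the kernel of `[1, 0] : B + A ⟶ B`. -/
noncomputable def flat (B A : 𝒞) : 𝒞 := kernel (coprod.desc (𝟙 B) (0 : A ⟶ B))

/-- The canonical monomorphism `B ♭ A ⟶ B + A`. -/
noncomputable def flatι (B A : 𝒞) : flat B A ⟶ B ⨿ A := kernel.ι _

instance (B A : 𝒞) : Mono (flatι B A) := by unfold flatι flat; infer_instance

/-- Morphisms into `B ♭ A`. -/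
noncomputable def flatLift {T B A : 𝒞} (f : T ⟶ B ⨿ A) (h : f ≫ coprod.desc (𝟙 B) 0 = 0) :
    T ⟶ flat B A := kernel.lift _ f h

lemma flatLift_ι {T B A : 𝒞} (f : T ⟶ B ⨿ A) (h : f ≫ coprod.desc (𝟙 B) 0 = 0) :
    flatLift f h ≫ flatι B A = f := kernel.lift_ι _ _ _

lemma flatι_desc (B A : 𝒞) : flatι B A ≫ coprod.desc (𝟙 B) 0 = 0 := kernel.condition _

/-- Functoriality of `♭` in both arguments. -/
noncomputable def flatMap {B B' A A' : 𝒞} (f : B ⟶ B') (g : A ⟶ A') : flat B A ⟶ flat B' A' :=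
  flatLift (flatι B A ≫ coprod.map f g) (by
    have h : coprod.map f g ≫ coprod.desc (𝟙 B') (0 : A' ⟶ B') =
        coprod.desc (𝟙 B) (0 : A ⟶ B) ≫ f := by ext <;> simp
    rw [Category.assoc, h, ← Category.assoc, flatι_desc, zero_comp])

lemma flatMap_ι {B B' A A' : 𝒞} (f : B ⟶ B') (g : A ⟶ A') :
    flatMap f g ≫ flatι B' A' = flatι B A ≫ coprod.map f g := flatLift_ι _ _

/-- The unit of the monad `B ♭ (-)`. -/
noncomputable def flatUnit (B A : 𝒞) : A ⟶ flat B A := flatLift coprod.inr (by simp)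

/-- The multiplication of the monad `B ♭ (-)`. -/
noncomputable def flatMul (B A : 𝒞) : flat B (flat B A) ⟶ flat B A :=
  flatLift (flatι B (flat B A) ≫ coprod.desc coprod.inl (flatι B A)) (by
    have h : coprod.desc coprod.inl (flatι B A) ≫ coprod.desc (𝟙 B) (0 : A ⟶ B) =
        coprod.desc (𝟙 B) (0 : flat B A ⟶ B) := by
      ext
      · simp
      · simp [flatι_desc]
    rw [Category.assoc, h, flatι_desc])

/-- The conjugation action `χ` of an object on itself. -/
noncomputable def conj (A : 𝒞) : flat A A ⟶ A := flatι A A ≫ coprod.desc (𝟙 A) (𝟙 A)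

variable (𝒞) in
/-- Internal crossed modules: a morphism `∂ : G ⟶ G₀` with an internal action `ξ` of `G₀` on `G`
(an algebra structure for the monad `G₀ ♭ (-)`), such that the Peiffer condition and the
precrossed module condition hold. -/
structure XMod where
  top : 𝒞
  base : 𝒞
  bd : top ⟶ base
  act : flat base top ⟶ top
  act_unit : flatUnit base top ≫ act = 𝟙 top
  act_mul : flatMul base top ≫ act = flatMap (𝟙 base) act ≫ act
  peiffer : flatMap bd (𝟙 top) ≫ act = conj top
  precrossed : act ≫ bd = flatMap (𝟙 base) bd ≫ conj base

/-! ### Normalization of internal groupoids -/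

namespace IntGroupoid

variable [HasPullbacks 𝒞] (G : IntGroupoid 𝒞)

/-- The kernel of the codomain. -/
noncomputable def ker : 𝒞 := kernel G.c

/-- The inclusion of the kernel of the codomain into the object of arrows. -/
noncomputable def kerι : G.ker ⟶ G.arr := kernel.ι G.c

instance : Mono G.kerι := by unfold kerι ker; infer_instance

lemma kerι_c : G.kerι ≫ G.c = 0 := kernel.condition _

/-- The action of `G₀` on the kernel of the codomain, the restriction of
`[e, g] : G₀ + G ⟶ G₁` to `G₀ ♭ G`. -/
noncomputable def kerAct : flat G.obj G.ker ⟶ G.ker :=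
  kernel.lift G.c (flatι G.obj G.ker ≫ coprod.desc G.e G.kerι) (by
    have h : coprod.desc G.e G.kerι ≫ G.c = coprod.desc (𝟙 G.obj) (0 : G.ker ⟶ G.obj) := by
      ext
      · simp [G.e_c]
      · simp [G.kerι_c]
    rw [Category.assoc, h, flatι_desc])

lemma kerAct_ι : G.kerAct ≫ G.kerι = flatι G.obj G.ker ≫ coprod.desc G.e G.kerι :=
  kernel.lift_ι _ _ _

/-- An arrow of `G₁` conjugates an arrow with codomain zero in the same way as the identity
of its domain does. -/
lemma conj_eq : flatι G.arr G.ker ≫ coprod.desc (𝟙 G.arr) G.kerι =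
    flatι G.arr G.ker ≫ coprod.desc (G.d ≫ G.e) G.kerι := by
  let Δ : G.arr ⟶ pullback G.c G.c := pullback.lift (𝟙 _) (𝟙 _) rfl
  let k : G.ker ⟶ pullback G.c G.c := pullback.lift G.kerι 0 (by simp [G.kerι_c])
  have hdiv : pullback.fst G.c G.c ≫ G.c = (pullback.snd G.c G.c ≫ G.i) ≫ G.d := by
    rw [Category.assoc, G.i_d, pullback.condition]
  let q : pullback G.c G.c ⟶ G.arr := G.comp (pullback.fst _ _) (pullback.snd _ _ ≫ G.i) hdiv
  have comp_zero : ∀ {T : 𝒞} (f : T ⟶ G.arr) (h : f ≫ G.c = 0 ≫ G.d), G.comp f 0 h = f := by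
    intro T f h
    rw [G.comp_congr rfl (zero_comp (f := G.e)).symm]
    exact G.comp_id f 0 _
  have hΔ : Δ ≫ q = G.d ≫ G.e := by
    rw [G.precomp, G.comp_congr (show Δ ≫ pullback.fst _ _ = 𝟙 _ by simp [Δ])
      (show Δ ≫ pullback.snd _ _ ≫ G.i = 𝟙 _ ≫ G.i by simp [Δ]), G.comp_inv, Category.id_comp]
  have hk : k ≫ q = G.kerι := by
    rw [G.precomp, G.comp_congr (show k ≫ pullback.fst _ _ = G.kerι by simp [k])
      (show k ≫ pullback.snd _ _ ≫ G.i = 0 by simp [k]), comp_zero]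
  have h₁ : coprod.desc (𝟙 G.arr) G.kerι = coprod.desc Δ k ≫ pullback.fst _ _ := by
    ext <;> simp [Δ, k]
  have h₂ : coprod.desc (G.d ≫ G.e) G.kerι = coprod.desc Δ k ≫ q := by
    ext
    · simp [hΔ]
    · simp [hk]
  have h₃ : coprod.desc Δ k ≫ pullback.snd _ _ = coprod.desc (𝟙 G.arr) (0 : G.ker ⟶ G.arr) := by
    ext <;> simp [Δ, k]
  have h₄ : (flatι G.arr G.ker ≫ coprod.desc Δ k) ≫ pullback.snd _ _ = 0 := by
    rw [Category.assoc, h₃, flatι_desc]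
  rw [h₁, h₂, ← Category.assoc, ← Category.assoc, G.precomp,
    G.comp_congr rfl (show (flatι G.arr G.ker ≫ coprod.desc Δ k) ≫ pullback.snd _ _ ≫ G.i = 0 by
      rw [← Category.assoc, h₄, zero_comp]), comp_zero]

/-- The normalization `J(G)` of an internal groupoid: the crossed module
`g ≫ d : G ⟶ G₀` with `g : G ⟶ G₁` the kernel of the codomain. -/
noncomputable def J : XMod 𝒞 where
  top := G.ker
  base := G.obj
  bd := G.kerι ≫ G.d
  act := G.kerAct
  act_unit := by
    rw [← cancel_mono G.kerι, Category.assoc, kerAct_ι, ← Category.assoc, flatUnit, flatLift_ι]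
    simp
  act_mul := by
    rw [← cancel_mono G.kerι, Category.assoc, Category.assoc, kerAct_ι, ← Category.assoc,
      ← Category.assoc, flatMul, flatLift_ι, flatMap_ι, Category.assoc, Category.assoc]
    congr 1
    ext
    · simp
    · simp [kerAct_ι]
  peiffer := by
    rw [← cancel_mono G.kerι, Category.assoc, kerAct_ι, ← Category.assoc, flatMap_ι]
    have h := congrArg (fun t => flatMap G.kerι (𝟙 G.ker) ≫ t) G.conj_eq
    simp only [← Category.assoc, flatMap_ι] at h
    simp only [Category.assoc, coprod.map_desc, Category.id_comp, Category.comp_id] at h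
    simp only [conj, Category.assoc, coprod.map_desc, Category.id_comp, coprod.desc_comp]
    exact h.symm
  precrossed := by
    rw [← Category.assoc, kerAct_ι, conj, ← Category.assoc, flatMap_ι, Category.assoc,
      Category.assoc]
    congr 1
    ext <;> simp [G.e_d]

end IntGroupoid

/-! ### Butterflies -/

/-- Butterflies from the crossed module `H` to the crossed module `G`. -/
structure Butterfly (H G : XMod 𝒞) where
  E : 𝒞
  κ : H.top ⟶ E
  ι : G.top ⟶ E
  σ : E ⟶ H.base
  ρ : E ⟶ G.base
  κ_σ : κ ≫ σ = H.bd
  ι_ρ : ι ≫ ρ = G.bd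
  κ_ρ : κ ≫ ρ = 0
  ι_σ : ι ≫ σ = 0
  isKernel : Nonempty (IsLimit (KernelFork.ofι ι ι_σ))
  isCokernel : Nonempty (IsColimit (CokernelCofork.ofπ σ ι_σ))
  κ_act : flatMap σ (𝟙 H.top) ≫ H.act ≫ κ = flatMap (𝟙 E) κ ≫ conj E
  ι_act : flatMap ρ (𝟙 G.top) ≫ G.act ≫ ι = flatMap (𝟙 E) ι ≫ conj E

/-- Morphisms of butterflies. -/
@[ext]
structure ButterflyHom {H G : XMod 𝒞} (E E' : Butterfly H G) where
  f : E.E ⟶ E'.E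
  κ_f : E.κ ≫ f = E'.κ
  ι_f : E.ι ≫ f = E'.ι
  f_σ : f ≫ E'.σ = E.σ
  f_ρ : f ≫ E'.ρ = E.ρ

/-- The category of butterflies from `H` to `G` and their morphisms; this is the hom-category of
the bicategory of crossed modules and butterflies. -/
instance Butterfly.category (H G : XMod 𝒞) : Category (Butterfly H G) where
  Hom E E' := ButterflyHom E E'
  id E := ⟨𝟙 E.E, by simp, by simp, by simp, by simp⟩
  comp a b := ⟨a.f ≫ b.f, by rw [← Category.assoc, a.κ_f, b.κ_f],
    by rw [← Category.assoc, a.ι_f, b.ι_f], by rw [Category.assoc, b.f_σ, a.f_σ],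
    by rw [Category.assoc, b.f_ρ, a.f_ρ]⟩
  id_comp a := ButterflyHom.ext (Category.id_comp a.f)
  comp_id a := ButterflyHom.ext (Category.comp_id a.f)
  assoc a b c := ButterflyHom.ext (Category.assoc a.f b.f c.f)

end CrossedModules

end SemiAb

/-!
Let `C` and `D` be internal groupoids. A butterfly `E` from `J C` to `J D` is the same as a
principal bibundle. The wing `κ`, equivariant along `σ`, amounts to an action of `C` on `E` over
`σ`: arrows `f : a ⟶ b` of `C` move elements of `E` over `b` to elements over `a`. The wing `ι`
amounts to an action of `D` on `E` over `ρ` (`exists_isAct`, `IsAct.kerAct_comp`). The `C`-action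
preserves `ρ` because `κ ≫ ρ = 0`, the `D`-action preserves `σ` because `ι ≫ σ = 0`, the two
actions commute, and `D` acts simply transitively on the fibres of `σ` because `ι` is the kernel
of `σ` (`existsUnique_smul_eq`). All these identities hold by protomodularity: the object of pairs
`(f, x)` with `c f = σ x` is a split extension of `E`, so two morphisms out of it agree as soon as
they agree on the kernel and on the section.

By projectivity the morphism `s₀ : X₀ ⟶ C.obj` lifts to some `x : X₀ ⟶ E` with `x ≫ σ = s₀`. The
internal functor represented by `(E, x)` sends an object `a` of the restriction `X` to `ρ (x a)`
and an arrow `f : a ⟶ b` to the unique arrow `δ` of `D` with `δ • (f • x b) = x a`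
(`Bibundle.toFunctor`). A morphism of butterflies `φ` goes to the natural transformation measuring
the difference between the chosen lift of the target and the image under `φ` of the chosen lift of
the source.

This is fully faithful. Every element of `E` is locally of the form `δ • x a`, since `s₀` is a
regular epimorphism and `D` acts transitively on the fibres of `σ`, so a morphism is determined by
its natural transformation (`Bibundle.hom_ext`), and a natural transformation gives a map on pairs
`(δ, a)` which descends to `E` (`Bibundle.exists_isHom`).

It is essentially surjective. Given an internal functor `F : X ⥤ D`, take the object of pairs
`(δ, a)` with `c δ = F a`, modulo the equivalence relation identifying `(δ, a)` with
`(δ', b)` when they differ by `F f` for an arrow `f` of `X` lying over an identity of `C`. By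
Barr-exactness the quotient exists and this relation is its kernel pair. It inherits both
actions and represents `F` (`IntFunctor.exists_toFunctor_eq`).

Finally, internal functors and internal natural transformations form a groupoid, hence so do the
butterflies.
-/

namespace SemiAb

/-! ### Regular epimorphisms and split extensions -/

section SplitExtensions

variable {𝒞 : Type u} [Category.{v} 𝒞]

lemma exists_desc_of_isRegularEpi {A B Z : 𝒞} (f : A ⟶ B) [IsRegularEpi f] (g : A ⟶ Z)
    (h : ∀ ⦃T : 𝒞⦄ (a b : T ⟶ A), a ≫ f = b ≫ f → a ≫ g = b ≫ g) : ∃ g' : B ⟶ Z, f ≫ g' = g :=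
  ⟨IsRegularEpi.desc f g (h _ _ (IsRegularEpi.w f)), IsRegularEpi.fac f g _⟩

/-- A generalized element of `B` lifts along a regular epimorphism `A ⟶ B` after passing to a
cover of its domain. -/
lemma exists_cover [Regular 𝒞] {A B T : 𝒞} (f : A ⟶ B) [IsRegularEpi f] (t : T ⟶ B) :
    ∃ (T' : 𝒞) (q : T' ⟶ T) (t' : T' ⟶ A), IsRegularEpi q ∧ t' ≫ f = q ≫ t :=
  ⟨pullback f t, pullback.snd f t, pullback.fst f t, inferInstance, pullback.condition⟩

lemma isRegularEpi_of_isRegularEpi_comp [Regular 𝒞] {X Y Z : 𝒞} (f : X ⟶ Y) (g : Y ⟶ Z)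
    [IsRegularEpi (f ≫ g)] : IsRegularEpi g := by
  have : StrongEpi g := strongEpi_of_strongEpi f g
  infer_instance

variable [HasZeroMorphisms 𝒞]

/-- Split extensions: `k` is a kernel of `p`, which is split by `s`. -/
structure IsSplitExt {K A B : 𝒞} (k : K ⟶ A) (p : A ⟶ B) (s : B ⟶ A) : Prop where
  w : k ≫ p = 0
  isKernel : Nonempty (IsLimit (KernelFork.ofι k w))
  section_retraction : s ≫ p = 𝟙 B

lemma nonempty_isLimit_kernelFork {K A B : 𝒞} {k : K ⟶ A} {p : A ⟶ B} (w : k ≫ p = 0) [Mono k]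
    (h : ∀ ⦃T : 𝒞⦄ (t : T ⟶ A), t ≫ p = 0 → ∃ u : T ⟶ K, u ≫ k = t) :
    Nonempty (IsLimit (KernelFork.ofι k w)) :=
  ⟨KernelFork.IsLimit.ofι k w (fun t ht => (h t ht).choose) (fun t ht => (h t ht).choose_spec)
    (fun t ht m hm => by rw [← cancel_mono k, hm, (h t ht).choose_spec])⟩

namespace IsSplitExt

variable {K A B : 𝒞} {k : K ⟶ A} {p : A ⟶ B} {s : B ⟶ A}

lemma mono (h : IsSplitExt k p s) : Mono k := by
  obtain ⟨hl⟩ := h.isKernel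
  exact ⟨fun a b hab => Fork.IsLimit.hom_ext hl hab⟩

lemma exists_lift (h : IsSplitExt k p s) {T : 𝒞} (t : T ⟶ A) (ht : t ≫ p = 0) :
    ∃ u : T ⟶ K, u ≫ k = t := by
  obtain ⟨hl⟩ := h.isKernel
  exact ⟨hl.lift (KernelFork.ofι t ht), hl.fac _ WalkingParallelPair.zero⟩

lemma of_exists_lift (w : k ≫ p = 0) [Mono k]
    (h : ∀ ⦃T : 𝒞⦄ (t : T ⟶ A), t ≫ p = 0 → ∃ u : T ⟶ K, u ≫ k = t) (hs : s ≫ p = 𝟙 B) :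
    IsSplitExt k p s :=
  ⟨w, nonempty_isLimit_kernelFork w h, hs⟩

variable [SemiAbelian 𝒞]

/-- The kernel and the section of a split epimorphism are jointly extremally epic: a subobject
through which both factor is everything. This is protomodularity. -/
lemma isIso_of_factor (h : IsSplitExt k p s) {I : 𝒞} (m : I ⟶ A) [Mono m] (k' : K ⟶ I)
    (s' : B ⟶ I) (hk : k' ≫ m = k) (hs : s' ≫ m = s) : IsIso m := by
  have := h.mono
  have : Mono k' := by
    have : Mono (k' ≫ m) := by rwa [hk]
    exact mono_of_mono k' m
  have h' : IsSplitExt k' (m ≫ p) s' :=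
    of_exists_lift (by rw [← Category.assoc, hk, h.w])
      (fun T t ht => by
        obtain ⟨u, hu⟩ := h.exists_lift (t ≫ m) (by rw [Category.assoc, ht])
        exact ⟨u, by rw [← cancel_mono m, Category.assoc, hk, hu]⟩)
      (by rw [← Category.assoc, hs, h.section_retraction])
  exact SemiAbelian.splitShortFive k' (m ≫ p) s' k p s (𝟙 _) m (𝟙 _) h'.w h.w h'.isKernel
    h.isKernel h'.section_retraction h.section_retraction (by rw [hk, Category.id_comp])
    (Category.comp_id _) (by rw [hs, Category.id_comp]) inferInstance inferInstance

lemma hom_ext (h : IsSplitExt k p s) {Z : 𝒞} {f g : A ⟶ Z} (hk : k ≫ f = k ≫ g)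
    (hs : s ≫ f = s ≫ g) : f = g := by
  have := h.isIso_of_factor (equalizer.ι f g) (equalizer.lift k hk) (equalizer.lift s hs)
    (equalizer.lift_ι _ _) (equalizer.lift_ι _ _)
  exact eq_of_epi_equalizer

lemma isRegularEpi_desc (h : IsSplitExt k p s) : IsRegularEpi (coprod.desc s k) := by
  let F := Regular.strongEpiMonoFactorisation (coprod.desc s k)
  have hF : F.e ≫ F.m = coprod.desc s k := F.fac
  have : IsIso F.m := h.isIso_of_factor F.m (coprod.inr ≫ F.e) (coprod.inl ≫ F.e)
    (by rw [Category.assoc, hF, coprod.inr_desc]) (by rw [Category.assoc, hF, coprod.inl_desc])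
  have : IsRegularEpi F.e := by dsimp only [F]; infer_instance
  rw [← hF]
  infer_instance

end IsSplitExt

variable [SemiAbelian 𝒞]

lemma isSplitExt_pullback_snd {K X Y Z : 𝒞} {f : X ⟶ Z} {g : Y ⟶ Z} {k : K ⟶ X} {w : k ≫ f = 0}
    (hk : Nonempty (IsLimit (KernelFork.ofι k w))) (s : Y ⟶ X) (hs : s ≫ f = g) :
    IsSplitExt (pullback.lift k 0 (by rw [w, zero_comp])) (pullback.snd f g)
      (pullback.lift s (𝟙 Y) (by rw [hs, Category.id_comp])) := by
  obtain ⟨hl⟩ := hk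
  have : Mono k := ⟨fun a b hab => Fork.IsLimit.hom_ext hl hab⟩
  have : Mono (pullback.lift k (0 : K ⟶ Y) (by rw [w, zero_comp]) : K ⟶ pullback f g) := by
    have : Mono ((pullback.lift k (0 : K ⟶ Y) (by rw [w, zero_comp]) : K ⟶ pullback f g) ≫
        pullback.fst f g) := by rwa [pullback.lift_fst]
    exact mono_of_mono _ (pullback.fst f g)
  refine IsSplitExt.of_exists_lift (pullback.lift_snd _ _ _) (fun T t ht => ?_)
    (pullback.lift_snd _ _ _)
  have ht' : (t ≫ pullback.fst f g) ≫ f = 0 := by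
    rw [Category.assoc, pullback.condition, ← Category.assoc, ht, zero_comp]
  refine ⟨hl.lift (KernelFork.ofι _ ht'), ?_⟩
  apply pullback.hom_ext
  · rw [Category.assoc, pullback.lift_fst]
    exact hl.fac (KernelFork.ofι _ ht') WalkingParallelPair.zero
  · rw [Category.assoc, pullback.lift_snd, comp_zero, ht]

/-- Regular epimorphisms are cokernels of their kernels. -/
lemma exists_desc_of_kernel {A B Z : 𝒞} (f : A ⟶ B) [IsRegularEpi f] (g : A ⟶ Z)
    (h : ∀ ⦃T : 𝒞⦄ (t : T ⟶ A), t ≫ f = 0 → t ≫ g = 0) : ∃ g' : B ⟶ Z, f ≫ g' = g := by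
  have key : pullback.fst f f ≫ g = pullback.snd f f ≫ g := by
    have hs := isSplitExt_pullback_snd (f := f) (g := f) (k := kernel.ι f)
      (w := kernel.condition f) ⟨kernelIsKernel f⟩ (𝟙 A) (Category.id_comp _)
    apply hs.hom_ext
    · rw [← Category.assoc, ← Category.assoc, pullback.lift_fst, pullback.lift_snd, zero_comp,
        h _ (kernel.condition f)]
    · rw [← Category.assoc, ← Category.assoc, pullback.lift_fst, pullback.lift_snd]
  refine exists_desc_of_isRegularEpi f g fun T a b hab => ?_
  have := congrArg (fun t => pullback.lift a b hab ≫ t) key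
  simpa only [← Category.assoc, pullback.lift_fst, pullback.lift_snd] using this

end SplitExtensions

/-! ### Calculus in internal groupoids -/

section GroupoidCalculus

variable {𝒞 : Type u} [Category.{v} 𝒞] [HasPullbacks 𝒞]

namespace IntGroupoid

variable (G : IntGroupoid 𝒞) {T : 𝒞}

lemma comp_right_cancel {f f' g : T ⟶ G.arr} (h : f ≫ G.c = g ≫ G.d) (h' : f' ≫ G.c = g ≫ G.d)
    (hfg : G.comp f g h = G.comp f' g h') : f = f' := by
  have key : ∀ (a : T ⟶ G.arr) (ha : a ≫ G.c = g ≫ G.d),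
      G.comp (G.comp a g ha) (g ≫ G.i) (by rw [G.comp_c, Category.assoc, G.i_d]) = a := by
    intro a ha
    rw [G.comp_assoc a g (g ≫ G.i) ha (by rw [Category.assoc, G.i_d]),
      G.comp_congr rfl (G.comp_inv g (by rw [Category.assoc, G.i_d]))]
    exact (G.comp_congr rfl (Category.assoc _ _ _).symm _).trans
      (G.comp_id a _ (by rw [ha]; simp [G.e_d]))
  rw [← key f h, ← key f' h']
  exact G.comp_congr hfg rfl _

lemma e_i : G.e ≫ G.i = G.e := by
  have h := G.inv_comp G.e (by rw [Category.assoc, G.i_c, G.e_d])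
  have h' := G.comp_id (G.e ≫ G.i) (𝟙 _) (by
    rw [Category.assoc, G.i_c, G.e_d, Category.id_comp, G.e_d])
  rw [G.comp_congr rfl (Category.id_comp G.e)] at h'
  rw [← h', h, ← Category.assoc, G.e_c, Category.id_comp]

end IntGroupoid

namespace IntFunctor

variable {G H : IntGroupoid 𝒞} (P : IntFunctor G H)

lemma condition {T : 𝒞} {f g : T ⟶ G.arr} (h : f ≫ G.c = g ≫ G.d) :
    (f ≫ P.arr) ≫ H.c = (g ≫ P.arr) ≫ H.d := by
  rw [Category.assoc, Category.assoc, P.w_c, P.w_d, ← Category.assoc, h, Category.assoc]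

lemma map_comp {T : 𝒞} (f g : T ⟶ G.arr) (h : f ≫ G.c = g ≫ G.d) :
    G.comp f g h ≫ P.arr = H.comp (f ≫ P.arr) (g ≫ P.arr) (P.condition h) := by
  have := H.precomp (pullback.lift f g h) (pullback.fst G.c G.d ≫ P.arr)
    (pullback.snd G.c G.d ≫ P.arr) (P.condition pullback.condition)
  unfold IntGroupoid.comp at this ⊢
  rw [Category.assoc, P.w_m, this]
  simp only [← Category.assoc, pullback.lift_fst, pullback.lift_snd]

end IntFunctor

namespace IntNatTrans

variable {G H : IntGroupoid 𝒞} {P Q : IntFunctor G H} (α : IntNatTrans P Q)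

lemma naturality_apply {T : 𝒞} (f : T ⟶ G.arr) (a b : T ⟶ G.obj) (ha : f ≫ G.d = a)
    (hb : f ≫ G.c = b) :
    H.comp (f ≫ P.arr) (b ≫ α.app)
        (by rw [Category.assoc, P.w_c, Category.assoc, α.app_d, ← hb, Category.assoc]) =
      H.comp (a ≫ α.app) (f ≫ Q.arr)
        (by rw [Category.assoc, Category.assoc, Q.w_d, α.app_c, ← ha, Category.assoc]) := by
  subst ha hb
  have h : H.comp P.arr (G.c ≫ α.app) _ = H.comp (G.d ≫ α.app) Q.arr _ := α.naturality
  have h' := congrArg (fun t => f ≫ t) h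
  simp only [H.precomp] at h'
  simpa only [Category.assoc] using h'

end IntNatTrans

/-- Internal natural transformations between functors of groupoids are invertible. -/
theorem IntFunctor.isGroupoid (G H : IntGroupoid 𝒞) : IsGroupoid (IntFunctor G H) where
  all_isIso {P Q} α := by
    change IntNatTrans P Q at α
    have hd : (α.app ≫ H.i) ≫ H.d = Q.obj := by rw [Category.assoc, H.i_d, α.app_c]
    have hc : (α.app ≫ H.i) ≫ H.c = P.obj := by rw [Category.assoc, H.i_c, α.app_d]
    have hN : H.comp P.arr (G.c ≫ α.app) _ = H.comp (G.d ≫ α.app) Q.arr _ := α.naturality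
    have inv_nat : H.comp Q.arr (G.c ≫ α.app ≫ H.i)
          (by rw [Q.w_c, Category.assoc, hd]) =
        H.comp (G.d ≫ α.app ≫ H.i) P.arr (by rw [P.w_d, Category.assoc, hc]) := by
      have h₁ : (G.d ≫ α.app ≫ H.i) ≫ H.c = (G.d ≫ α.app) ≫ H.d := by simp [H.i_c]
      have h₂ : (G.c ≫ α.app ≫ H.i) ≫ H.c = (G.c ≫ α.app) ≫ H.d := by simp [H.i_c]
      have h₃ : (G.d ≫ α.app ≫ H.i) ≫ H.c = P.arr ≫ H.d := by rw [P.w_d, Category.assoc, hc]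
      have h₄ : P.arr ≫ H.c = (G.c ≫ α.app) ≫ H.d := by
        rw [P.w_c, Category.assoc, α.app_d]
      have h₅ : Q.arr ≫ H.c = (G.c ≫ α.app ≫ H.i) ≫ H.d := by
        rw [Q.w_c, Category.assoc, hd]
      have h₆ : (G.d ≫ α.app) ≫ H.c = Q.arr ≫ H.d := by
        rw [Q.w_d, Category.assoc, α.app_c]
      refine H.comp_right_cancel (g := G.c ≫ α.app) (by rw [H.comp_c, h₂])
        (by rw [H.comp_c, h₄]) ?_
      rw [H.comp_assoc _ _ _ h₅ h₂, H.comp_assoc _ _ _ h₃ h₄, H.comp_congr rfl hN,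
        ← H.comp_assoc _ _ _ h₁ h₆]
      have e₁ : H.comp (G.c ≫ α.app ≫ H.i) (G.c ≫ α.app) h₂ = (G.c ≫ Q.obj) ≫ H.e := by
        have := H.inv_comp (G.c ≫ α.app) (by simpa using h₂)
        simp only [Category.assoc] at this ⊢
        rw [this, ← α.app_c]
        simp
      have e₂ : H.comp (G.d ≫ α.app ≫ H.i) (G.d ≫ α.app) h₁ = (G.d ≫ Q.obj) ≫ H.e := by
        have := H.inv_comp (G.d ≫ α.app) (by simpa using h₁)
        simp only [Category.assoc] at this ⊢
        rw [this, ← α.app_c]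
        simp
      rw [H.comp_congr rfl e₁, H.comp_congr e₂ rfl, H.comp_id, H.id_comp]
    refine ⟨(show IntNatTrans Q P from ⟨α.app ≫ H.i, hd, hc, inv_nat⟩), ?_, ?_⟩
    · apply IntNatTrans.ext
      change H.comp α.app (α.app ≫ H.i) _ = P.obj ≫ H.e
      rw [H.comp_inv, ← Category.assoc, α.app_d]
    · apply IntNatTrans.ext
      change H.comp (α.app ≫ H.i) α.app _ = Q.obj ≫ H.e
      rw [H.inv_comp, ← Category.assoc, α.app_c]

end GroupoidCalculus

/-! ### Actions of internal groupoids on objects -/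

section Actions

variable {𝒞 : Type u} [Category.{v} 𝒞]

section Smul

variable [HasPullbacks 𝒞] {G : IntGroupoid 𝒞} {E : 𝒞} {r : E ⟶ G.obj}

/-- The action `f • x` of a generalized arrow on a generalized element of `E`, for
a morphism `m` defined on the pairs `(f, x)` such that `r x` is the codomain of `f`. -/
noncomputable def smul (m : pullback G.c r ⟶ E) {T : 𝒞} (f : T ⟶ G.arr) (x : T ⟶ E)
    (h : f ≫ G.c = x ≫ r) : T ⟶ E :=
  pullback.lift f x h ≫ m

variable (m : pullback G.c r ⟶ E)

lemma comp_smul {S T : 𝒞} (t : S ⟶ T) (f : T ⟶ G.arr) (x : T ⟶ E) (h : f ≫ G.c = x ≫ r) :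
    t ≫ smul m f x h = smul m (t ≫ f) (t ≫ x) (by simp [h]) := by
  unfold smul
  rw [← Category.assoc]
  congr 1
  apply pullback.hom_ext <;> simp [pullback.lift_fst, pullback.lift_snd]

lemma smul_congr {T : 𝒞} {f f' : T ⟶ G.arr} {x x' : T ⟶ E} (hf : f = f') (hx : x = x')
    (h : f ≫ G.c = x ≫ r) : smul m f x h = smul m f' x' (by rw [← hf, ← hx, h]) := by
  subst hf hx
  rfl

lemma lift_comp_eq_smul {T : 𝒞} (f : T ⟶ G.arr) (x : T ⟶ E) (h : f ≫ G.c = x ≫ r) :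
    pullback.lift f x h ≫ m = smul m f x h := rfl

lemma smul_fst_snd : smul m (pullback.fst G.c r) (pullback.snd G.c r) pullback.condition = m := by
  unfold smul
  rw [show pullback.lift (pullback.fst G.c r) (pullback.snd G.c r) pullback.condition = 𝟙 _ from
    pullback.hom_ext (by simp) (by simp), Category.id_comp]

end Smul

variable [HasZeroMorphisms 𝒞] [SemiAbelian 𝒞]

lemma pullback_lift_zero {X Y Z T : 𝒞} {f : X ⟶ Z} {g : Y ⟶ Z} (h : (0 : T ⟶ X) ≫ f = 0 ≫ g) :
    pullback.lift 0 0 h = 0 := by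
  apply pullback.hom_ext <;> simp [pullback.lift_fst, pullback.lift_snd]

lemma IntGroupoid.comp_zero (G : IntGroupoid 𝒞) {T : 𝒞} (f : T ⟶ G.arr)
    (h : f ≫ G.c = 0 ≫ G.d) : G.comp f 0 h = f := by
  rw [G.comp_congr rfl (zero_comp (f := G.e)).symm]
  exact G.comp_id f 0 _

lemma IntGroupoid.exists_lift_kerι (G : IntGroupoid 𝒞) {T : 𝒞} (t : T ⟶ G.arr)
    (ht : t ≫ G.c = 0) : ∃ u : T ⟶ G.ker, u ≫ G.kerι = t :=
  ⟨kernel.lift G.c t ht, kernel.lift_ι _ _ _⟩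

/-- The morphism `m` is a unital action of the groupoid `G` on the object `E` over `G₀`, and its
restriction to the kernel of the codomain (that is, its value on pairs `(g, 0)`) is `k`.
Associativity is a consequence, see `IsAct.smul_smul`. -/
structure IsAct (G : IntGroupoid 𝒞) {E : 𝒞} (r : E ⟶ G.obj) (k : G.ker ⟶ E)
    (m : pullback G.c r ⟶ E) : Prop where
  k_r : k ≫ r = G.kerι ≫ G.d
  unit : smul m (r ≫ G.e) (𝟙 E) (by simp [G.e_c]) = 𝟙 E
  ker : smul m G.kerι 0 (by simp [G.kerι_c]) = k

lemma isSplitExt_action (G : IntGroupoid 𝒞) {E : 𝒞} (r : E ⟶ G.obj) :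
    IsSplitExt (pullback.lift G.kerι 0 (by simp [G.kerι_c])) (pullback.snd G.c r)
      (pullback.lift (r ≫ G.e) (𝟙 E) (by simp [G.e_c])) :=
  isSplitExt_pullback_snd (w := G.kerι_c) ⟨kernelIsKernel G.c⟩ (r ≫ G.e) (by simp [G.e_c])

/-- Two operations on a pullback along the codomain of a groupoid agree as soon as they agree on
identities and on the kernel of the codomain. -/
lemma action_hom_ext {G : IntGroupoid 𝒞} {E Z : 𝒞} {r : E ⟶ G.obj} {f g : pullback G.c r ⟶ Z}
    (hk : pullback.lift G.kerι 0 (by simp [G.kerι_c]) ≫ f =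
      pullback.lift G.kerι 0 (by simp [G.kerι_c]) ≫ g)
    (hs : pullback.lift (r ≫ G.e) (𝟙 E) (by simp [G.e_c]) ≫ f =
      pullback.lift (r ≫ G.e) (𝟙 E) (by simp [G.e_c]) ≫ g) : f = g :=
  (isSplitExt_action G r).hom_ext hk hs

namespace IsAct

variable {G : IntGroupoid 𝒞} {E : 𝒞} {r : E ⟶ G.obj} {k : G.ker ⟶ E}
  {m : pullback G.c r ⟶ E} (hm : IsAct G r k m) {T : 𝒞}

include hm

lemma unit_smul {f : T ⟶ G.arr} {x : T ⟶ E} (h : f ≫ G.c = x ≫ r) (hf : f = x ≫ r ≫ G.e) :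
    smul m f x h = x := by
  have := congrArg (fun t => x ≫ t) hm.unit
  simp only [comp_smul, Category.comp_id] at this
  subst hf
  exact this

lemma ker_smul {f : T ⟶ G.arr} {x : T ⟶ E} (h : f ≫ G.c = x ≫ r) (g : T ⟶ G.ker)
    (hf : f = g ≫ G.kerι) (hx : x = 0) : smul m f x h = g ≫ k := by
  have := congrArg (fun t => g ≫ t) hm.ker
  simp only [comp_smul, comp_zero] at this
  subst hf hx
  exact this

lemma smul_r (f : T ⟶ G.arr) (x : T ⟶ E) (h : f ≫ G.c = x ≫ r) :
    smul m f x h ≫ r = f ≫ G.d := by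
  have key : m ≫ r = pullback.fst G.c r ≫ G.d := by
    apply action_hom_ext
    · simp only [← Category.assoc, lift_comp_eq_smul, pullback.lift_fst, hm.ker, hm.k_r]
    · simp only [← Category.assoc, lift_comp_eq_smul, pullback.lift_fst, hm.unit]
      simp [G.e_d]
  unfold smul
  rw [Category.assoc, key, ← Category.assoc, pullback.lift_fst]

/-- A morphism over `G₀` and under the kernel of the codomain is equivariant. -/
lemma smul_comp {E' : 𝒞} {r' : E' ⟶ G.obj} {k' : G.ker ⟶ E'} {m' : pullback G.c r' ⟶ E'}
    (hm' : IsAct G r' k' m') (φ : E ⟶ E') (hr : φ ≫ r' = r) (hk : k ≫ φ = k')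
    (f : T ⟶ G.arr) (x : T ⟶ E) (h : f ≫ G.c = x ≫ r) :
    smul m f x h ≫ φ = smul m' f (x ≫ φ) (by rw [Category.assoc, hr, h]) := by
  have key : m ≫ φ = smul m' (pullback.fst G.c r) (pullback.snd G.c r ≫ φ)
      (by rw [Category.assoc, hr, pullback.condition]) := by
    apply action_hom_ext
    · rw [← Category.assoc, lift_comp_eq_smul, hm.ker, comp_smul,
        hm'.ker_smul _ (𝟙 _) (by simp [pullback.lift_fst])
          (by rw [← Category.assoc, pullback.lift_snd, zero_comp]), hk, Category.id_comp]
    · rw [← Category.assoc, lift_comp_eq_smul, hm.unit, comp_smul,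
        hm'.unit_smul _ (by
          rw [pullback.lift_fst, pullback.lift_snd_assoc, Category.id_comp,
            ← Category.assoc, hr]), ← Category.assoc, pullback.lift_snd]
  have := congrArg (fun t => pullback.lift f x h ≫ t) key
  rw [comp_smul, smul_congr m' (pullback.lift_fst _ _ _)
    (by rw [← Category.assoc, pullback.lift_snd])] at this
  unfold smul at this ⊢
  rw [Category.assoc, this]

lemma comp_condition {f g : T ⟶ G.arr} {x : T ⟶ E} (hfg : f ≫ G.c = g ≫ G.d)
    (h : g ≫ G.c = x ≫ r) : f ≫ G.c = smul m g x h ≫ r := by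
  rw [hm.smul_r, hfg]

/-- Associativity is automatic: it holds when the outer arrow is an identity, and when it is
an element of the kernel of the codomain with all other arguments zero. -/
lemma smul_smul (f g : T ⟶ G.arr) (x : T ⟶ E) (hfg : f ≫ G.c = g ≫ G.d)
    (h : g ≫ G.c = x ≫ r) :
    smul m f (smul m g x h) (hm.comp_condition hfg h) =
      smul m (G.comp f g hfg) x (by rw [G.comp_c, h]) := by
  let g₀ := pullback.fst G.c r
  let x₀ := pullback.snd G.c r
  have h₀ : g₀ ≫ G.c = x₀ ≫ r := pullback.condition
  let f₁ := pullback.fst G.c (g₀ ≫ G.d)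
  let g₁ := pullback.snd G.c (g₀ ≫ G.d) ≫ g₀
  let x₁ := pullback.snd G.c (g₀ ≫ G.d) ≫ x₀
  have h₁ : f₁ ≫ G.c = g₁ ≫ G.d := by
    simpa [f₁, g₁] using pullback.condition (f := G.c) (g := g₀ ≫ G.d)
  have h₂ : g₁ ≫ G.c = x₁ ≫ r := by simp [g₁, x₁, h₀]
  have key : smul m f₁ (smul m g₁ x₁ h₂) (hm.comp_condition h₁ h₂) =
      smul m (G.comp f₁ g₁ h₁) x₁ (by rw [G.comp_c, h₂]) := by
    apply action_hom_ext
    · have e₁ : pullback.lift G.kerι 0 (by simp [G.kerι_c]) ≫ f₁ = G.kerι :=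
        pullback.lift_fst _ _ _
      have e₂ : pullback.lift G.kerι 0 (by simp [G.kerι_c]) ≫ g₁ = 0 := by
        simp only [g₁, ← Category.assoc, pullback.lift_snd, zero_comp]
      have e₃ : pullback.lift G.kerι 0 (by simp [G.kerι_c]) ≫ x₁ = 0 := by
        simp only [x₁, ← Category.assoc, pullback.lift_snd, zero_comp]
      simp only [comp_smul, G.precomp, e₁, e₂, e₃, G.comp_zero]
      refine smul_congr m rfl ?_ _
      unfold smul
      rw [pullback_lift_zero, zero_comp]
    · have e₁ : pullback.lift ((g₀ ≫ G.d) ≫ G.e) (𝟙 _) (by simp [G.e_c]) ≫ f₁ =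
        (g₀ ≫ G.d) ≫ G.e := pullback.lift_fst _ _ _
      have e₂ : pullback.lift ((g₀ ≫ G.d) ≫ G.e) (𝟙 _) (by simp [G.e_c]) ≫ g₁ = g₀ := by
        simp only [g₁, ← Category.assoc, pullback.lift_snd, Category.id_comp]
      have e₃ : pullback.lift ((g₀ ≫ G.d) ≫ G.e) (𝟙 _) (by simp [G.e_c]) ≫ x₁ = x₀ := by
        simp only [x₁, ← Category.assoc, pullback.lift_snd, Category.id_comp]
      simp only [comp_smul, G.precomp, e₁, e₂, e₃, G.id_comp]
      exact hm.unit_smul _ (by rw [← Category.assoc, hm.smul_r])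
  have e := congrArg (fun t => pullback.lift f (pullback.lift g x h)
    (by rw [← Category.assoc, pullback.lift_fst, hfg]) ≫ t) key
  have e₁ : pullback.lift f (pullback.lift g x h)
    (by rw [← Category.assoc, pullback.lift_fst, hfg]) ≫ f₁ = f := pullback.lift_fst _ _ _
  have e₂ : pullback.lift f (pullback.lift g x h)
      (by rw [← Category.assoc, pullback.lift_fst, hfg]) ≫ g₁ = g := by
    simp only [g₁, g₀, ← Category.assoc, pullback.lift_snd, pullback.lift_fst]
  have e₃ : pullback.lift f (pullback.lift g x h)
      (by rw [← Category.assoc, pullback.lift_fst, hfg]) ≫ x₁ = x := by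
    simp only [x₁, x₀, ← Category.assoc, pullback.lift_snd]
  simpa only [comp_smul, G.precomp, e₁, e₂, e₃] using e

/-- The action preserves every morphism `s` out of `E` that vanishes on the kernel. -/
lemma smul_comp_eq {B : 𝒞} {s : E ⟶ B} (hk : k ≫ s = 0) (f : T ⟶ G.arr)
    (x : T ⟶ E) (h : f ≫ G.c = x ≫ r) :
    smul m f x h ≫ s = x ≫ s := by
  have key : m ≫ s = pullback.snd G.c r ≫ s := by
    apply action_hom_ext
    · simp only [← Category.assoc, lift_comp_eq_smul, pullback.lift_snd, hm.ker, hk, zero_comp]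
    · simp only [← Category.assoc, lift_comp_eq_smul, pullback.lift_snd, hm.unit]
  unfold smul
  rw [Category.assoc, key, ← Category.assoc, pullback.lift_snd]

section Commute

variable {H : IntGroupoid 𝒞} {s : E ⟶ H.obj} {l : H.ker ⟶ E} {n : pullback H.c s ⟶ E}

/-- Two actions on `E` commute as soon as each of the two kernels acts over the base of the other
action. -/
lemma smul_smul_comm (hn : IsAct H s l n) (hk : k ≫ s = 0) (hl : l ≫ r = 0)
    (f : T ⟶ G.arr) (g : T ⟶ H.arr) (x : T ⟶ E) (hf : f ≫ G.c = x ≫ r) (hg : g ≫ H.c = x ≫ s) :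
    smul m f (smul n g x hg) (by rw [hn.smul_comp_eq hl, hf]) =
      smul n g (smul m f x hf) (by rw [hm.smul_comp_eq hk, hg]) := by
  let g₀ := pullback.fst H.c s
  let x₀ := pullback.snd H.c s
  have h₀ : g₀ ≫ H.c = x₀ ≫ s := pullback.condition
  let f₁ := pullback.fst G.c (x₀ ≫ r)
  let g₁ := pullback.snd G.c (x₀ ≫ r) ≫ g₀
  let x₁ := pullback.snd G.c (x₀ ≫ r) ≫ x₀
  have h₁ : f₁ ≫ G.c = x₁ ≫ r := by
    simpa [f₁, x₁] using pullback.condition (f := G.c) (g := x₀ ≫ r)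
  have h₂ : g₁ ≫ H.c = x₁ ≫ s := by simp [g₁, x₁, h₀]
  have key : smul m f₁ (smul n g₁ x₁ h₂) (by rw [hn.smul_comp_eq hl, h₁]) =
      smul n g₁ (smul m f₁ x₁ h₁) (by rw [hm.smul_comp_eq hk, h₂]) := by
    apply action_hom_ext
    · have e₁ : pullback.lift G.kerι 0 (by simp [G.kerι_c]) ≫ f₁ = G.kerι :=
        pullback.lift_fst _ _ _
      have e₂ : pullback.lift G.kerι 0 (by simp [G.kerι_c]) ≫ g₁ = 0 := by
        simp only [g₁, ← Category.assoc, pullback.lift_snd, zero_comp]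
      have e₃ : pullback.lift G.kerι 0 (by simp [G.kerι_c]) ≫ x₁ = 0 := by
        simp only [x₁, ← Category.assoc, pullback.lift_snd, zero_comp]
      simp only [comp_smul, e₁, e₂, e₃]
      rw [smul_congr m rfl (show smul n 0 0 _ = 0 by
        unfold smul; rw [pullback_lift_zero, zero_comp])]
      refine (hn.unit_smul _ ?_).symm
      rw [hm.ker, ← Category.assoc, hk, zero_comp]
    · have e₁ : pullback.lift ((x₀ ≫ r) ≫ G.e) (𝟙 _) (by simp [G.e_c]) ≫ f₁ =
        (x₀ ≫ r) ≫ G.e := pullback.lift_fst _ _ _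
      have e₂ : pullback.lift ((x₀ ≫ r) ≫ G.e) (𝟙 _) (by simp [G.e_c]) ≫ g₁ = g₀ := by
        simp only [g₁, ← Category.assoc, pullback.lift_snd, Category.id_comp]
      have e₃ : pullback.lift ((x₀ ≫ r) ≫ G.e) (𝟙 _) (by simp [G.e_c]) ≫ x₁ = x₀ := by
        simp only [x₁, ← Category.assoc, pullback.lift_snd, Category.id_comp]
      simp only [comp_smul, e₁, e₂, e₃]
      rw [hm.unit_smul _ (by rw [← Category.assoc, hn.smul_comp_eq hl])]
      exact smul_congr n rfl (hm.unit_smul _ (Category.assoc _ _ _)).symm _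
  have e := congrArg (fun t => pullback.lift f (pullback.lift g x hg)
    (by rw [← Category.assoc, pullback.lift_snd, hf]) ≫ t) key
  have e₁ : pullback.lift f (pullback.lift g x hg)
    (by rw [← Category.assoc, pullback.lift_snd, hf]) ≫ f₁ = f := pullback.lift_fst _ _ _
  have e₂ : pullback.lift f (pullback.lift g x hg)
      (by rw [← Category.assoc, pullback.lift_snd, hf]) ≫ g₁ = g := by
    simp only [g₁, g₀, ← Category.assoc, pullback.lift_snd, pullback.lift_fst]
  have e₃ : pullback.lift f (pullback.lift g x hg)
      (by rw [← Category.assoc, pullback.lift_snd, hf]) ≫ x₁ = x := by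
    simp only [x₁, x₀, ← Category.assoc, pullback.lift_snd]
  simpa only [comp_smul, e₁, e₂, e₃] using e

end Commute

lemma smul_left_cancel {f : T ⟶ G.arr} {x y : T ⟶ E} (hx : f ≫ G.c = x ≫ r)
    (hy : f ≫ G.c = y ≫ r) (hxy : smul m f x hx = smul m f y hy) : x = y := by
  have key : ∀ (z : T ⟶ E) (hz : f ≫ G.c = z ≫ r),
      smul m (f ≫ G.i) (smul m f z hz) (by rw [hm.smul_r, Category.assoc, G.i_c]) = z := by
    intro z hz
    rw [hm.smul_smul (f ≫ G.i) f z (by rw [Category.assoc, G.i_c]) hz,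
      smul_congr m (G.inv_comp f (by rw [Category.assoc, G.i_c])) rfl]
    exact hm.unit_smul _ (by rw [← Category.assoc, hz, Category.assoc])
  rw [← key x hx, ← key y hy]
  exact smul_congr m rfl hxy _

/-- If the restriction `k` of the action is a kernel of `s`, the action is simply transitive on the
fibres of `s`. -/
lemma existsUnique_smul_eq {B : 𝒞} {s : E ⟶ B} {w : k ≫ s = 0}
    (hk : Nonempty (IsLimit (KernelFork.ofι k w))) (x y : T ⟶ E) (hxy : x ≫ s = y ≫ s) :
    ∃! f : T ⟶ G.arr, ∃ h : f ≫ G.c = y ≫ r, smul m f y h = x := by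
  let q : pullback G.c r ⟶ pullback s s := pullback.lift m (pullback.snd G.c r) (by
    have := hm.smul_comp_eq w (pullback.fst G.c r) (pullback.snd G.c r) pullback.condition
    rwa [smul_fst_snd] at this)
  have h₁ := isSplitExt_action G r
  have h₂ := isSplitExt_pullback_snd (f := s) (g := s) hk (𝟙 E) (Category.id_comp _)
  have hq : IsIso q := by
    refine SemiAbelian.splitShortFive _ _ _ _ _ _ (𝟙 G.ker) q (𝟙 E) h₁.w h₂.w h₁.isKernel
      h₂.isKernel h₁.section_retraction h₂.section_retraction ?_ ?_ ?_ inferInstance inferInstance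
    · rw [Category.id_comp]
      apply pullback.hom_ext
      · rw [Category.assoc, pullback.lift_fst, pullback.lift_fst]
        exact hm.ker
      · rw [Category.assoc, pullback.lift_snd, pullback.lift_snd, pullback.lift_snd]
    · rw [Category.comp_id, pullback.lift_snd]
    · refine Eq.trans ?_ (Category.id_comp _).symm
      apply pullback.hom_ext
      · rw [Category.assoc, pullback.lift_fst, pullback.lift_fst]
        exact hm.unit
      · rw [Category.assoc, pullback.lift_snd, pullback.lift_snd, pullback.lift_snd]
  have hsnd : inv q ≫ pullback.snd G.c r = pullback.snd s s := by
    rw [IsIso.inv_comp_eq, pullback.lift_snd]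
  have hfst : inv q ≫ m = pullback.fst s s := by
    rw [IsIso.inv_comp_eq, pullback.lift_fst]
  let z := pullback.lift x y hxy ≫ inv q
  have hz : z ≫ pullback.snd G.c r = y := by
    rw [Category.assoc, hsnd, pullback.lift_snd]
  have hz' : (z ≫ pullback.fst G.c r) ≫ G.c = y ≫ r := by
    rw [Category.assoc, pullback.condition, ← Category.assoc, hz]
  refine ⟨z ≫ pullback.fst G.c r, ⟨hz', ?_⟩, ?_⟩
  · have : pullback.lift (z ≫ pullback.fst G.c r) y hz' = z := by
      apply pullback.hom_ext
      · rw [pullback.lift_fst]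
      · rw [pullback.lift_snd, hz]
    unfold smul
    rw [this, Category.assoc, hfst, pullback.lift_fst]
  · rintro f ⟨h, hf⟩
    have : pullback.lift f y h = z := by
      rw [← cancel_mono q, Category.assoc, IsIso.inv_hom_id, Category.comp_id]
      apply pullback.hom_ext
      · rw [Category.assoc, pullback.lift_fst, pullback.lift_fst]
        exact hf
      · rw [Category.assoc, pullback.lift_snd, pullback.lift_snd, pullback.lift_snd]
    rw [← this, pullback.lift_fst]

/-- The restriction of an action to the kernel of the codomain carries the canonical action of
`G₀` to conjugation. -/
lemma kerAct_comp : flatMap r (𝟙 G.ker) ≫ G.kerAct ≫ k = flatMap (𝟙 E) k ≫ conj E := by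
  let t : flat E G.ker ⟶ pullback G.c r := flatι E G.ker ≫
    coprod.desc (pullback.lift (r ≫ G.e) (𝟙 E) (by simp [G.e_c]))
      (pullback.lift G.kerι 0 (by simp [G.kerι_c]))
  have h₁ : t ≫ m = flatMap (𝟙 E) k ≫ conj E := by
    have e : coprod.desc (pullback.lift (r ≫ G.e) (𝟙 E) (by simp [G.e_c]))
        (pullback.lift G.kerι 0 (by simp [G.kerι_c])) ≫ m = coprod.desc (𝟙 E) k := by
      ext
      · rw [← Category.assoc, coprod.inl_desc, coprod.inl_desc]
        exact hm.unit
      · rw [← Category.assoc, coprod.inr_desc, coprod.inr_desc]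
        exact hm.ker
    unfold conj
    rw [Category.assoc, e, ← Category.assoc, flatMap_ι, Category.assoc, coprod.map_desc,
      Category.comp_id, Category.comp_id]
  have h₂ : t = (flatMap r (𝟙 G.ker) ≫ G.kerAct) ≫
      pullback.lift G.kerι 0 (by simp [G.kerι_c]) := by
    apply pullback.hom_ext
    · have e : coprod.desc (pullback.lift (r ≫ G.e) (𝟙 E) (by simp [G.e_c]))
          (pullback.lift G.kerι 0 (by simp [G.kerι_c])) ≫ pullback.fst G.c r =
            coprod.map r (𝟙 G.ker) ≫ coprod.desc G.e G.kerι := by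
        ext <;> simp [pullback.lift_fst, coprod.inl_desc, coprod.inr_desc]
      rw [Category.assoc, e, Category.assoc, pullback.lift_fst, Category.assoc, G.kerAct_ι,
        ← Category.assoc, ← Category.assoc, flatMap_ι]
    · have e : coprod.desc (pullback.lift (r ≫ G.e) (𝟙 E) (by simp [G.e_c]))
          (pullback.lift G.kerι 0 (by simp [G.kerι_c])) ≫ pullback.snd G.c r =
            coprod.desc (𝟙 E) 0 := by
        ext <;> simp [pullback.lift_snd, coprod.inl_desc, coprod.inr_desc]
      rw [Category.assoc, e, flatι_desc, Category.assoc, pullback.lift_snd, comp_zero]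
  rw [← h₁, h₂]
  simp only [Category.assoc]
  congr 2
  exact hm.ker.symm

end IsAct

/-- A morphism `k` that carries the canonical action of `G₀` on the kernel of the codomain to
conjugation extends to an action of `G`: by protomodularity, the pairs `(f, x)` form a regular
quotient of the coproduct of `E` and the kernel, and the morphism induced by the identity and
`k` on that coproduct annihilates the kernel of the quotient morphism. -/
lemma exists_isAct {G : IntGroupoid 𝒞} {E : 𝒞} {r : E ⟶ G.obj} {k : G.ker ⟶ E}
    (hr : k ≫ r = G.kerι ≫ G.d)
    (hk : flatMap r (𝟙 G.ker) ≫ G.kerAct ≫ k = flatMap (𝟙 E) k ≫ conj E) :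
    ∃ m : pullback G.c r ⟶ E, IsAct G r k m := by
  let π := coprod.desc (pullback.lift (r ≫ G.e) (𝟙 E) (by simp [G.e_c]))
    (pullback.lift G.kerι 0 (by simp [G.kerι_c]) : _ ⟶ pullback G.c r)
  have hπ : IsRegularEpi π := (isSplitExt_action G r).isRegularEpi_desc
  have π_fst : π ≫ pullback.fst G.c r = coprod.map r (𝟙 G.ker) ≫ coprod.desc G.e G.kerι := by
    ext <;> simp [π, pullback.lift_fst, coprod.inl_desc, coprod.inr_desc]
  have π_snd : π ≫ pullback.snd G.c r = coprod.desc (𝟙 E) 0 := by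
    ext <;> simp [π, pullback.lift_snd, coprod.inl_desc, coprod.inr_desc]
  obtain ⟨m, hm⟩ := exists_desc_of_kernel π (coprod.desc (𝟙 E) k) fun T t ht => by
    have h₁ : t ≫ coprod.desc (𝟙 E) (0 : G.ker ⟶ E) = 0 := by
      rw [← π_snd, ← Category.assoc, ht, zero_comp]
    let u := flatLift t h₁
    have hu : u ≫ flatι E G.ker = t := flatLift_ι t h₁
    have h₂ : u ≫ flatMap r (𝟙 G.ker) ≫ G.kerAct = 0 := by
      rw [← cancel_mono G.kerι, zero_comp, Category.assoc, Category.assoc, G.kerAct_ι,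
        ← Category.assoc (flatMap _ _), flatMap_ι, Category.assoc, ← π_fst, ← Category.assoc, hu,
        ← Category.assoc, ht, zero_comp]
    have h₃ : flatι E G.ker ≫ coprod.desc (𝟙 E) k = flatMap (𝟙 E) k ≫ conj E := by
      unfold conj
      rw [← Category.assoc, flatMap_ι, Category.assoc, coprod.map_desc, Category.comp_id,
        Category.comp_id]
    rw [← hu, Category.assoc, h₃, ← hk, ← Category.assoc, ← Category.assoc, Category.assoc u, h₂,
      zero_comp]
  refine ⟨m, hr, ?_, ?_⟩
  · have := congrArg (fun t => coprod.inl ≫ t) hm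
    simpa only [π, ← Category.assoc, coprod.inl_desc, lift_comp_eq_smul] using this
  · have := congrArg (fun t => coprod.inr ≫ t) hm
    simpa only [π, ← Category.assoc, coprod.inr_desc, lift_comp_eq_smul] using this

end Actions

/-! ### Principal bibundles -/

section Bibundles

variable {𝒞 : Type u} [Category.{v} 𝒞] [HasZeroMorphisms 𝒞] [SemiAbelian 𝒞]

/-- Principal bibundles from `C` to `D`: objects `E` over `C₀` and `D₀` with actions of `C` and of
`D`, where `D` acts simply transitively on the fibres of the regular epimorphism `σ : E ⟶ C₀`. Since
actions are determined by their restrictions to the kernels of the codomains, these restrictions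
`κ` and `ι` are recorded as well; simple transitivity is expressed by `ι` being a kernel of `σ`. -/
structure Bibundle (C D : IntGroupoid 𝒞) where
  E : 𝒞
  σ : E ⟶ C.obj
  ρ : E ⟶ D.obj
  κ : C.ker ⟶ E
  ι : D.ker ⟶ E
  left : pullback C.c σ ⟶ E
  right : pullback D.c ρ ⟶ E
  isAct_left : IsAct C σ κ left
  isAct_right : IsAct D ρ ι right
  κ_ρ : κ ≫ ρ = 0
  ι_σ : ι ≫ σ = 0
  isKernel : Nonempty (IsLimit (KernelFork.ofι ι ι_σ))
  isRegularEpi : IsRegularEpi σ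

namespace Bibundle

variable {C D : IntGroupoid 𝒞}

/-- Morphisms of bibundles, that is, morphisms of the corresponding butterflies. -/
structure IsHom (A B : Bibundle C D) (φ : A.E ⟶ B.E) : Prop where
  κ_comp : A.κ ≫ φ = B.κ
  ι_comp : A.ι ≫ φ = B.ι
  comp_σ : φ ≫ B.σ = A.σ
  comp_ρ : φ ≫ B.ρ = A.ρ

section Division

variable (B : Bibundle C D) {T : 𝒞}

/-- The unique arrow of `D` that carries `y` to `x`, for `x` and `y` in the same fibre of `σ`. -/
noncomputable def div (x y : T ⟶ B.E) (h : x ≫ B.σ = y ≫ B.σ) : T ⟶ D.arr :=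
  (B.isAct_right.existsUnique_smul_eq B.isKernel x y h).choose

variable {x y : T ⟶ B.E} (h : x ≫ B.σ = y ≫ B.σ)

lemma div_c : B.div x y h ≫ D.c = y ≫ B.ρ :=
  (B.isAct_right.existsUnique_smul_eq B.isKernel x y h).choose_spec.1.1

lemma div_smul : smul B.right (B.div x y h) y (B.div_c h) = x :=
  (B.isAct_right.existsUnique_smul_eq B.isKernel x y h).choose_spec.1.2

lemma div_d : B.div x y h ≫ D.d = x ≫ B.ρ := by
  rw [← B.isAct_right.smul_r _ _ (B.div_c h), B.div_smul]

lemma eq_div {f : T ⟶ D.arr} (hf : f ≫ D.c = y ≫ B.ρ) (hfy : smul B.right f y hf = x) :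
    f = B.div x y h :=
  (B.isAct_right.existsUnique_smul_eq B.isKernel x y h).unique ⟨hf, hfy⟩
    ⟨B.div_c h, B.div_smul h⟩

lemma smul_right_cancel {f g : T ⟶ D.arr} (hf : f ≫ D.c = y ≫ B.ρ) (hg : g ≫ D.c = y ≫ B.ρ)
    (hfg : smul B.right f y hf = smul B.right g y hg) : f = g := by
  have hσ : smul B.right f y hf ≫ B.σ = y ≫ B.σ := B.isAct_right.smul_comp_eq B.ι_σ _ _ _
  rw [B.eq_div hσ hf rfl, B.eq_div hσ hg hfg.symm]

lemma comp_div {S : 𝒞} (t : S ⟶ T) :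
    t ≫ B.div x y h = B.div (t ≫ x) (t ≫ y) (by simp [h]) := by
  apply B.eq_div
  rw [← comp_smul B.right t _ _ (B.div_c h), B.div_smul]

end Division

/-! ### The functor represented by a bibundle with a lift -/

section ToFunctor

variable {X : IntGroupoid 𝒞} (B : Bibundle C D) (S : IntFunctor X C) (x : X.obj ⟶ B.E)
  (hx : x ≫ B.σ = S.obj)

include hx in
lemma left_condition {T : 𝒞} {f : T ⟶ X.arr} {b : T ⟶ X.obj} (hb : f ≫ X.c = b) :
    (f ≫ S.arr) ≫ C.c = (b ≫ x) ≫ B.σ := by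
  rw [Category.assoc, S.w_c, ← Category.assoc, hb, Category.assoc, hx]

include hx in
lemma arr_condition : (X.d ≫ x) ≫ B.σ =
    smul B.left S.arr (X.c ≫ x) (by rw [S.w_c, Category.assoc, hx]) ≫ B.σ := by
  rw [B.isAct_left.smul_r, Category.assoc, hx, S.w_d]

/-- The morphism on arrows of the functor represented by `B`: it sends `f : a ⟶ b` to the arrow of
`D` that carries `S f • x b` to `x a`. -/
noncomputable def functorArr : X.arr ⟶ D.arr :=
  B.div (X.d ≫ x) (smul B.left S.arr (X.c ≫ x) (by rw [S.w_c, Category.assoc, hx]))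
    (B.arr_condition S x hx)

lemma functorArr_c : B.functorArr S x hx ≫ D.c = X.c ≫ x ≫ B.ρ := by
  rw [functorArr, div_c, B.isAct_left.smul_comp_eq B.κ_ρ, Category.assoc]

lemma functorArr_d : B.functorArr S x hx ≫ D.d = X.d ≫ x ≫ B.ρ := by
  rw [functorArr, div_d, Category.assoc]

lemma functorArr_condition {T : 𝒞} {f : T ⟶ X.arr} {b : T ⟶ X.obj} (hb : f ≫ X.c = b) :
    (f ≫ B.functorArr S x hx) ≫ D.c =
      smul B.left (f ≫ S.arr) (b ≫ x) (B.left_condition S x hx hb) ≫ B.ρ := by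
  rw [B.isAct_left.smul_comp_eq B.κ_ρ, Category.assoc, functorArr_c, ← Category.assoc, hb,
    Category.assoc]

/-- The defining property of the functor represented by `B`, on generalized arrows `f : a ⟶ b`. -/
lemma functorArr_smul {T : 𝒞} (f : T ⟶ X.arr) (a b : T ⟶ X.obj) (ha : f ≫ X.d = a)
    (hb : f ≫ X.c = b) :
    smul B.right (f ≫ B.functorArr S x hx)
      (smul B.left (f ≫ S.arr) (b ≫ x) (B.left_condition S x hx hb))
      (B.functorArr_condition S x hx hb) = a ≫ x := by
  subst ha hb
  have := congrArg (fun t => f ≫ t) (B.div_smul (B.arr_condition S x hx))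
  simp only [comp_smul] at this
  unfold functorArr
  simpa only [Category.assoc] using this

/-- The functor `X ⟶ D` represented by a bibundle `B` from `C` to `D`, a functor `S : X ⟶ C` and
a lift `x` of its object morphism along `σ`. -/
noncomputable def toFunctor : IntFunctor X D where
  obj := x ≫ B.ρ
  arr := B.functorArr S x hx
  w_d := B.functorArr_d S x hx
  w_c := B.functorArr_c S x hx
  w_e := by
    have h := B.functorArr_smul S x hx X.e (𝟙 _) (𝟙 _) X.e_d X.e_c
    have h' : smul B.left (X.e ≫ S.arr) (𝟙 _ ≫ x) (B.left_condition S x hx X.e_c) = x := by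
      rw [B.isAct_left.unit_smul _ (by rw [S.w_e, Category.id_comp, ← hx, Category.assoc]),
        Category.id_comp]
    rw [smul_congr B.right rfl h'] at h
    refine B.smul_right_cancel (y := x) _ (by simp [D.e_c])
      ((h.trans (Category.id_comp x)).trans ?_)
    exact (B.isAct_right.unit_smul _ (Category.assoc _ _ _)).symm
  w_m := by
    let f := pullback.fst X.c X.d
    let g := pullback.snd X.c X.d
    have hfg : f ≫ X.c = g ≫ X.d := pullback.condition
    have hm : X.m = X.comp f g hfg := by
      unfold IntGroupoid.comp
      rw [show pullback.lift f g hfg = 𝟙 _ from pullback.hom_ext (by simp [f, pullback.lift_fst])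
        (by simp [g, pullback.lift_snd]), Category.id_comp]
    let F := B.functorArr S x hx
    have hF : (f ≫ F) ≫ D.c = (g ≫ F) ≫ D.d := by
      rw [Category.assoc, Category.assoc, B.functorArr_c, B.functorArr_d, ← Category.assoc, hfg,
        Category.assoc]
    have hS := S.condition hfg
    change X.m ≫ F = D.comp (f ≫ F) (g ≫ F) hF
    have h₁ := B.functorArr_smul S x hx X.m (f ≫ X.d) (g ≫ X.c) X.m_d X.m_c
    refine B.smul_right_cancel (B.functorArr_condition S x hx X.m_c) ?_ (h₁.trans ?_)
    · rw [D.comp_c, B.isAct_left.smul_comp_eq B.κ_ρ, Category.assoc, B.functorArr_c]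
      simp only [Category.assoc, g]
    · have hg := B.left_condition S x hx (f := g) rfl
      have e₁ : smul B.left (X.m ≫ S.arr) ((g ≫ X.c) ≫ x) (B.left_condition S x hx X.m_c) =
          smul B.left (f ≫ S.arr) (smul B.left (g ≫ S.arr) ((g ≫ X.c) ≫ x) hg)
            (B.isAct_left.comp_condition hS hg) := by
        rw [B.isAct_left.smul_smul _ _ _ hS hg]
        exact smul_congr _ (by rw [hm, S.map_comp]) rfl _
      have hgF := B.functorArr_condition S x hx (f := g) rfl
      rw [smul_congr B.right rfl e₁, ← B.isAct_right.smul_smul _ _ _ hF (by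
          rw [B.isAct_left.smul_comp_eq B.κ_ρ]; exact hgF)]
      have e₂ := B.isAct_left.smul_smul_comm B.isAct_right B.κ_ρ B.ι_σ (f ≫ S.arr) (g ≫ F)
        (smul B.left (g ≫ S.arr) ((g ≫ X.c) ≫ x) hg) (B.isAct_left.comp_condition hS hg) hgF
      rw [← smul_congr B.right rfl e₂]
      have e₃ := B.functorArr_smul S x hx g (f ≫ X.c) _ hfg.symm rfl
      rw [smul_congr B.right rfl (smul_congr B.left rfl e₃ _)]
      · exact (B.functorArr_smul S x hx f _ _ rfl rfl).symm
      · rw [B.isAct_left.smul_comp_eq B.κ_ρ, B.isAct_right.smul_r, hF]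

end ToFunctor

end Bibundle

end Bibundles

namespace Bibundle

/-! ### Morphisms of bibundles and natural transformations -/

section NatTrans

variable {𝒞 : Type u} [Category.{v} 𝒞] [HasZeroMorphisms 𝒞] [SemiAbelian 𝒞]
  {C D X : IntGroupoid 𝒞} {A B : Bibundle C D} {S : IntFunctor X C}
  {x : X.obj ⟶ A.E} {hx : x ≫ A.σ = S.obj} {y : X.obj ⟶ B.E} {hy : y ≫ B.σ = S.obj}

namespace IsHom

variable {φ : A.E ⟶ B.E} (hφ : IsHom A B φ)

include hφ

lemma left_comp {T : 𝒞} (f : T ⟶ C.arr) (z : T ⟶ A.E) (h : f ≫ C.c = z ≫ A.σ) :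
    smul A.left f z h ≫ φ =
      smul B.left f (z ≫ φ) (by rw [Category.assoc, hφ.comp_σ, h]) :=
  A.isAct_left.smul_comp B.isAct_left φ hφ.comp_σ hφ.κ_comp f z h

lemma right_comp {T : 𝒞} (f : T ⟶ D.arr) (z : T ⟶ A.E) (h : f ≫ D.c = z ≫ A.ρ) :
    smul A.right f z h ≫ φ =
      smul B.right f (z ≫ φ) (by rw [Category.assoc, hφ.comp_ρ, h]) :=
  A.isAct_right.smul_comp B.isAct_right φ hφ.comp_ρ hφ.ι_comp f z h

end IsHom

lemma arr_comp_app {Q : IntFunctor X D} (α : IntNatTrans (A.toFunctor S x hx) Q) {T : 𝒞}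
    {f : T ⟶ X.arr} {b : T ⟶ X.obj} (hb : f ≫ X.c = b) :
    (f ≫ A.functorArr S x hx) ≫ D.c = (b ≫ α.app) ≫ D.d := by
  rw [Category.assoc, functorArr_c, Category.assoc, α.app_d, ← hb, Category.assoc]
  rfl

lemma app_c_toFunctor {P : IntFunctor X D} (α : IntNatTrans P (B.toFunctor S y hy)) :
    α.app ≫ D.c = y ≫ B.ρ :=
  α.app_c

lemma app_c_eq {P : IntFunctor X D} (α : IntNatTrans P (B.toFunctor S y hy)) {T : 𝒞}
    (b : T ⟶ X.obj) : (b ≫ α.app) ≫ D.c = (b ≫ y) ≫ B.ρ := by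
  rw [Category.assoc, α.app_c, Category.assoc]
  rfl

/-- How the composite of a value of the functor represented by `A` with a component of `α` acts
on `B`, on generalized arrows `f : a ⟶ b`. This is the naturality of `α`, seen in `B`. -/
lemma smul_functorArr_comp (α : IntNatTrans (A.toFunctor S x hx) (B.toFunctor S y hy)) {T : 𝒞}
    (f : T ⟶ X.arr) (a b : T ⟶ X.obj) (ha : f ≫ X.d = a) (hb : f ≫ X.c = b) :
    smul B.right (D.comp (f ≫ A.functorArr S x hx) (b ≫ α.app) (arr_comp_app α hb))
        (smul B.left (f ≫ S.arr) (b ≫ y) (B.left_condition S y hy hb))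
        (by rw [D.comp_c, app_c_eq, B.isAct_left.smul_comp_eq B.κ_ρ]) =
      smul B.right (a ≫ α.app) (a ≫ y) (app_c_eq α a) := by
  have h := α.naturality_apply f a b ha hb
  have h' : D.comp (f ≫ A.functorArr S x hx) (b ≫ α.app) (arr_comp_app α hb) =
      D.comp (a ≫ α.app) (f ≫ B.functorArr S y hy) (by
        rw [app_c_eq, Category.assoc f, functorArr_d, ← Category.assoc f, ha, Category.assoc]) := h
  rw [smul_congr B.right h' rfl, ← B.isAct_right.smul_smul _ _ _ _
    (B.functorArr_condition S y hy hb)]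
  exact smul_congr B.right rfl (B.functorArr_smul S y hy f a b ha hb) _

lemma hom_condition {φ : A.E ⟶ B.E} (hφ : IsHom A B φ) (hx : x ≫ A.σ = S.obj)
    (hy : y ≫ B.σ = S.obj) : (x ≫ φ) ≫ B.σ = y ≫ B.σ := by
  rw [Category.assoc, hφ.comp_σ, hx, hy]

/-- The natural transformation induced by a morphism `φ` of bibundles: its component at `a` is the
arrow of `D` that carries `y a` to `φ (x a)`. -/
noncomputable def natTrans {φ : A.E ⟶ B.E} (hφ : IsHom A B φ) (hx : x ≫ A.σ = S.obj)
    (hy : y ≫ B.σ = S.obj) : IntNatTrans (A.toFunctor S x hx) (B.toFunctor S y hy) where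
  app := B.div (x ≫ φ) y (hom_condition hφ hx hy)
  app_d := by
    rw [div_d, Category.assoc, hφ.comp_ρ]
    rfl
  app_c := B.div_c _
  naturality := by
    let α := B.div (x ≫ φ) y (hom_condition hφ hx hy)
    have hα : smul B.right α y (B.div_c _) = x ≫ φ := B.div_smul _
    have hαb : ∀ b : X.arr ⟶ X.obj, smul B.right (b ≫ α) (b ≫ y)
        (by rw [Category.assoc, B.div_c, Category.assoc]) = b ≫ x ≫ φ := by
      intro b
      rw [← comp_smul B.right b α y (B.div_c _), hα]
    let F := A.functorArr S x hx
    let F' := B.functorArr S y hy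
    have hα_d : α ≫ D.d = x ≫ A.ρ := by rw [div_d, Category.assoc, hφ.comp_ρ]
    have h₁ : F ≫ D.c = (X.c ≫ α) ≫ D.d := by
      rw [A.functorArr_c, Category.assoc, hα_d]
    have h₂ : (X.d ≫ α) ≫ D.c = F' ≫ D.d := by
      rw [B.functorArr_d, Category.assoc, B.div_c]
    change D.comp F (X.c ≫ α) h₁ = D.comp (X.d ≫ α) F' h₂
    have hS := B.left_condition S y hy (Category.id_comp X.c)
    have hF := A.functorArr_smul S x hx (𝟙 _) X.d X.c (Category.id_comp _) (Category.id_comp _)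
    have hF' := B.functorArr_smul S y hy (𝟙 _) X.d X.c (Category.id_comp _) (Category.id_comp _)
    have hc₁ : (X.c ≫ α) ≫ D.c = (X.c ≫ y) ≫ B.ρ := by
      rw [Category.assoc, B.div_c, Category.assoc]
    have hc₂ : F' ≫ D.c = (X.c ≫ y) ≫ B.ρ := by
      rw [B.functorArr_c, Category.assoc]
    have hLρ : smul B.left (𝟙 _ ≫ S.arr) (X.c ≫ y) hS ≫ B.ρ = (X.c ≫ y) ≫ B.ρ :=
      B.isAct_left.smul_comp_eq B.κ_ρ _ _ _
    refine B.smul_right_cancel (y := smul B.left (𝟙 _ ≫ S.arr) (X.c ≫ y) hS)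
      (by rw [D.comp_c, hc₁, hLρ]) (by rw [D.comp_c, hc₂, hLρ]) ?_
    rw [← B.isAct_right.smul_smul _ _ _ h₁ (by rw [hc₁, hLρ]),
      ← B.isAct_right.smul_smul _ _ _ h₂ (by rw [hc₂, hLρ])]
    have e₁ : smul B.right (X.c ≫ α) (smul B.left (𝟙 _ ≫ S.arr) (X.c ≫ y) hS)
        (by rw [hc₁, hLρ]) =
          smul A.left (𝟙 _ ≫ S.arr) (X.c ≫ x) (A.left_condition S x hx (Category.id_comp X.c)) ≫
            φ := by
      rw [← B.isAct_left.smul_smul_comm B.isAct_right B.κ_ρ B.ι_σ _ _ _ hS hc₁,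
        hφ.left_comp]
      exact smul_congr B.left rfl ((hαb X.c).trans (Category.assoc _ _ _).symm) _
    have e₂ : smul B.right F' (smul B.left (𝟙 _ ≫ S.arr) (X.c ≫ y) hS)
        (by rw [hc₂, hLρ]) = X.d ≫ y :=
      (smul_congr B.right (Category.id_comp _).symm rfl _).trans hF'
    rw [smul_congr B.right rfl e₁, smul_congr B.right rfl e₂, hαb X.d, ← Category.assoc, ← hF,
      hφ.right_comp]
    exact smul_congr B.right (Category.id_comp _).symm rfl _

lemma natTrans_app_id (hx : x ≫ A.σ = S.obj) (hφ : IsHom A A (𝟙 A.E)) :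
    (natTrans hφ hx hx).app = (x ≫ A.ρ) ≫ D.e := by
  have hc : ((x ≫ A.ρ) ≫ D.e) ≫ D.c = x ≫ A.ρ := by simp [D.e_c]
  refine (A.eq_div (hom_condition hφ hx hx) hc ?_).symm
  exact (A.isAct_right.unit_smul hc (Category.assoc _ _ _)).trans (Category.comp_id _).symm

lemma natTrans_app_comp {B' : Bibundle C D} {z : X.obj ⟶ B'.E} (hx : x ≫ A.σ = S.obj)
    (hy : y ≫ B.σ = S.obj) (hz : z ≫ B'.σ = S.obj) {φ : A.E ⟶ B.E} {ψ : B.E ⟶ B'.E}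
    (hφ : IsHom A B φ) (hψ : IsHom B B' ψ) (hφψ : IsHom A B' (φ ≫ ψ)) :
    (natTrans hφψ hx hz).app = D.comp (natTrans hφ hx hy).app (natTrans hψ hy hz).app
      ((natTrans hφ hx hy).app_c.trans (natTrans hψ hy hz).app_d.symm) := by
  have h : B.div (x ≫ φ) y (hom_condition hφ hx hy) ≫ D.c =
      B'.div (y ≫ ψ) z (hom_condition hψ hy hz) ≫ D.d := by
    rw [div_c, div_d, Category.assoc, hψ.comp_ρ]
  refine (B'.eq_div (hom_condition hφψ hx hz)
    (f := D.comp (B.div (x ≫ φ) y (hom_condition hφ hx hy))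
      (B'.div (y ≫ ψ) z (hom_condition hψ hy hz)) h) (by rw [D.comp_c, div_c]) ?_).symm
  rw [← B'.isAct_right.smul_smul _ _ _ h (div_c _ _)]
  refine (smul_congr _ rfl (B'.div_smul _) _).trans ((hψ.right_comp _ y (div_c _ _)).symm.trans ?_)
  rw [B.div_smul, Category.assoc]

/-- A morphism of bibundles is determined by its values on the lift `x`: since `S` is a regular
epimorphism on objects, every element of `A` is locally of the form `δ • x a`. -/
lemma hom_ext [IsRegularEpi S.obj] (hx : x ≫ A.σ = S.obj) {φ ψ : A.E ⟶ B.E} (hφ : IsHom A B φ)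
    (hψ : IsHom A B ψ) (h : x ≫ φ = x ≫ ψ) : φ = ψ := by
  rw [← cancel_epi (pullback.snd S.obj A.σ)]
  let a := pullback.fst S.obj A.σ
  let z := pullback.snd S.obj A.σ
  have hz : z ≫ A.σ = (a ≫ x) ≫ A.σ := by
    rw [Category.assoc, hx, ← pullback.condition]
  change z ≫ φ = z ≫ ψ
  rw [← A.div_smul hz, hφ.right_comp, hψ.right_comp]
  exact smul_congr B.right rfl (by rw [Category.assoc, h, Category.assoc]) _

/-- Every natural transformation between the functors represented by two bibundles is induced by
a morphism of bibundles, namely by `δ • x a ↦ (δ ≫ α a) • y a`. -/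
lemma exists_isHom [IsRegularEpi S.obj] (hS : C.IsRestriction S.obj X.d X.c S.arr)
    (α : IntNatTrans (A.toFunctor S x hx) (B.toFunctor S y hy)) :
    ∃ φ : A.E ⟶ B.E, IsHom A B φ ∧ smul B.right α.app y (app_c_toFunctor α) = x ≫ φ := by
  have div_cond : ∀ {T : 𝒞} (z : T ⟶ A.E) (a : T ⟶ X.obj), a ≫ S.obj = z ≫ A.σ →
      z ≫ A.σ = (a ≫ x) ≫ A.σ := by
    intro T z a h
    rw [Category.assoc, hx, h]
  have comp_cond : ∀ {T : 𝒞} (z : T ⟶ A.E) (a : T ⟶ X.obj) (h : a ≫ S.obj = z ≫ A.σ),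
      A.div z (a ≫ x) (div_cond z a h) ≫ D.c = (a ≫ α.app) ≫ D.d := by
    intro T z a h
    rw [div_c, Category.assoc, Category.assoc, α.app_d]
    rfl
  -- the value of the morphism on `z`, computed with the help of `a` over the same object of `C`
  let val : ∀ {T : 𝒞} (z : T ⟶ A.E) (a : T ⟶ X.obj) (h : a ≫ S.obj = z ≫ A.σ), T ⟶ B.E :=
    fun z a h => smul B.right (D.comp (A.div z (a ≫ x) (div_cond z a h)) (a ≫ α.app)
      (comp_cond z a h)) (a ≫ y) (by rw [D.comp_c, app_c_eq])
  have comp_val : ∀ {T' T : 𝒞} (t : T' ⟶ T) (z : T ⟶ A.E) (a : T ⟶ X.obj)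
      (h : a ≫ S.obj = z ≫ A.σ),
      t ≫ val z a h = val (t ≫ z) (t ≫ a) (by rw [Category.assoc, h, Category.assoc]) := by
    intro T' T t z a h
    simp only [val, comp_smul, D.precomp, comp_div, Category.assoc]
  have val_congr : ∀ {T : 𝒞} {z z' : T ⟶ A.E} {a a' : T ⟶ X.obj} (h : a ≫ S.obj = z ≫ A.σ)
      (hz : z = z') (ha : a = a'), val z a h = val z' a' (by rw [← hz, ← ha, h]) := by
    intro T z z' a a' h hz ha
    subst hz ha
    rfl
  -- independence of the choice of `a`
  have val_eq : ∀ {T : 𝒞} (z : T ⟶ A.E) (a b : T ⟶ X.obj) (ha : a ≫ S.obj = z ≫ A.σ)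
      (hb : b ≫ S.obj = z ≫ A.σ), val z a ha = val z b hb := by
    intro T z a b ha hb
    let j : T ⟶ X.arr := hS.lift a b ((a ≫ S.obj) ≫ C.e) (by simp [C.e_d])
      (by simp [C.e_c, ha, hb])
    have jd : j ≫ X.d = a := hS.lift_d _ _ _ _ _
    have jc : j ≫ X.c = b := hS.lift_c _ _ _ _ _
    have js : j ≫ S.arr = (a ≫ S.obj) ≫ C.e := hS.lift_s _ _ _ _ _
    let F := A.functorArr S x hx
    have hL : ∀ (A' : Bibundle C D) (x' : X.obj ⟶ A'.E) (hx' : x' ≫ A'.σ = S.obj),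
        smul A'.left (j ≫ S.arr) (b ≫ x') (A'.left_condition S x' hx' jc) = b ≫ x' := by
      intro A' x' hx'
      refine A'.isAct_left.unit_smul _ ?_
      rw [js, Category.assoc b, ← Category.assoc x', hx', ← Category.assoc b, ha, hb]
    have hFc : (j ≫ F) ≫ D.c = (b ≫ x) ≫ A.ρ := by
      rw [Category.assoc, functorArr_c, ← Category.assoc, jc, Category.assoc]
    have hF : smul A.right (j ≫ F) (b ≫ x) hFc = a ≫ x :=
      (smul_congr A.right rfl (hL A x hx).symm _).trans (A.functorArr_smul S x hx j a b jd jc)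
    have hδ : A.div z (a ≫ x) (div_cond z a ha) ≫ D.c = (j ≫ F) ≫ D.d := by
      rw [div_c, Category.assoc j, functorArr_d, ← Category.assoc j, jd, Category.assoc]
    have hdiv : A.div z (b ≫ x) (div_cond z b hb) =
        D.comp (A.div z (a ≫ x) (div_cond z a ha)) (j ≫ F) hδ := by
      symm
      apply A.eq_div
      · rw [← A.isAct_right.smul_smul _ _ _ hδ hFc, smul_congr A.right rfl hF, A.div_smul]
    have hα := smul_functorArr_comp α j a b jd jc
    rw [smul_congr B.right rfl (hL B y hy)] at hα
    have hcc := arr_comp_app α jc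
    have h₁ : D.comp (A.div z (b ≫ x) (div_cond z b hb)) (b ≫ α.app) (comp_cond z b hb) =
        D.comp (A.div z (a ≫ x) (div_cond z a ha)) (D.comp (j ≫ F) (b ≫ α.app) hcc)
          (by rw [hδ, D.comp_d]) :=
      (D.comp_congr hdiv rfl _).trans (D.comp_assoc _ _ _ hδ hcc)
    dsimp only [val]
    exact (B.isAct_right.smul_smul _ _ _ (comp_cond z a ha) (app_c_eq α a)).symm.trans
      ((smul_congr B.right rfl hα.symm _).trans ((B.isAct_right.smul_smul _ _ _
        (by rw [hδ, D.comp_d]) (by rw [D.comp_c, app_c_eq])).trans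
          (smul_congr B.right h₁.symm rfl _)))
  let a₀ := pullback.fst S.obj A.σ
  let z₀ := pullback.snd S.obj A.σ
  have h₀ : a₀ ≫ S.obj = z₀ ≫ A.σ := pullback.condition
  obtain ⟨φ, hφ⟩ := exists_desc_of_isRegularEpi z₀ (val z₀ a₀ h₀) fun T s t hst => by
    have hs : (s ≫ a₀) ≫ S.obj = (s ≫ z₀) ≫ A.σ := by rw [Category.assoc, h₀, Category.assoc]
    have ht : (t ≫ a₀) ≫ S.obj = (t ≫ z₀) ≫ A.σ := by rw [Category.assoc, h₀, Category.assoc]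
    exact (comp_val s z₀ a₀ h₀).trans ((val_congr hs hst rfl).trans
      ((val_eq (t ≫ z₀) (s ≫ a₀) (t ≫ a₀) (by rw [hs, hst]) ht).trans
        (comp_val t z₀ a₀ h₀).symm))
  have comp_φ : ∀ {T : 𝒞} (z : T ⟶ A.E) (a : T ⟶ X.obj) (h : a ≫ S.obj = z ≫ A.σ),
      z ≫ φ = val z a h := by
    intro T z a h
    have e : pullback.lift a z h ≫ z₀ = z := pullback.lift_snd _ _ _
    have e' : (pullback.lift a z h ≫ a₀) ≫ S.obj = (pullback.lift a z h ≫ z₀) ≫ A.σ := by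
      rw [Category.assoc, h₀, Category.assoc]
    exact (congrArg (fun t => t ≫ φ) e).symm.trans ((Category.assoc _ _ _).trans
      ((congrArg (fun t => pullback.lift a z h ≫ t) hφ).trans ((comp_val _ z₀ a₀ h₀).trans
        (val_congr e' e (pullback.lift_fst _ _ _)))))
  have hxφ : smul B.right α.app y (app_c_toFunctor α) = x ≫ φ := by
    rw [comp_φ x (𝟙 _) (by rw [Category.id_comp, hx])]
    refine smul_congr B.right ?_ (Category.id_comp y).symm _
    have : A.div x (𝟙 _ ≫ x) (div_cond x (𝟙 _) (by rw [Category.id_comp, hx])) =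
        (x ≫ A.ρ) ≫ D.e := by
      symm
      apply A.eq_div
      · refine (A.isAct_right.unit_smul ?_ ?_).trans (Category.id_comp x)
        · simp [D.e_c]
        · rw [Category.id_comp, Category.assoc]
    rw [D.comp_congr this (Category.id_comp _), D.id_comp]
  have ι_comp : A.ι ≫ φ = B.ι := by
    rw [comp_φ A.ι 0 (by rw [zero_comp, A.ι_σ])]
    have : A.div A.ι (0 ≫ x) (by rw [zero_comp, zero_comp, A.ι_σ]) = D.kerι := by
      symm
      apply A.eq_div
      · exact (A.isAct_right.ker_smul (by simp [D.kerι_c]) (𝟙 _) (Category.id_comp _).symm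
          zero_comp).trans (Category.id_comp _)
    refine (B.isAct_right.ker_smul _ (𝟙 _) ?_ zero_comp).trans (Category.id_comp _)
    rw [D.comp_congr this zero_comp, D.comp_zero, Category.id_comp]
  have comp_ρ : φ ≫ B.ρ = A.ρ := by
    rw [← cancel_epi z₀, ← Category.assoc, hφ, B.isAct_right.smul_r, D.comp_d, div_d]
  have comp_σ : φ ≫ B.σ = A.σ := by
    rw [← cancel_epi z₀, ← Category.assoc, hφ, B.isAct_right.smul_comp_eq B.ι_σ, Category.assoc,
      hy, h₀]
  have right_comp : ∀ {T : 𝒞} (f : T ⟶ D.arr) (z : T ⟶ A.E) (h : f ≫ D.c = z ≫ A.ρ),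
      smul A.right f z h ≫ φ = smul B.right f (z ≫ φ) (by rw [Category.assoc, comp_ρ, h]) :=
    fun f z h => A.isAct_right.smul_comp B.isAct_right φ comp_ρ ι_comp f z h
  refine ⟨φ, ⟨?_, ι_comp, comp_σ, comp_ρ⟩, hxφ⟩
  -- an element `k` of the kernel of the codomain of `C` lifts locally to an arrow `f : a ⟶ 0` of
  -- `X`, and both functors express `κ k` through the value of `x` or `y` at `a`
  obtain ⟨T, q, a, hq, ha⟩ := exists_cover S.obj (C.kerι ≫ C.d)
  rw [← cancel_epi q]
  let f : T ⟶ X.arr := hS.lift a 0 (q ≫ C.kerι) (by rw [Category.assoc, ha])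
    (by rw [Category.assoc, C.kerι_c, zero_comp, comp_zero])
  have fd : f ≫ X.d = a := hS.lift_d _ _ _ _ _
  have fc : f ≫ X.c = 0 := hS.lift_c _ _ _ _ _
  have fs : f ≫ S.arr = q ≫ C.kerι := hS.lift_s _ _ _ _ _
  have hA := A.functorArr_smul S x hx f a 0 fd fc
  rw [smul_congr A.right rfl (A.isAct_left.ker_smul _ q fs zero_comp)] at hA
  have hB := smul_functorArr_comp α f a 0 fd fc
  rw [smul_congr B.right rfl (B.isAct_left.ker_smul _ q fs zero_comp),
    smul_congr B.right ((D.comp_congr rfl zero_comp _).trans (D.comp_zero _ _)) rfl] at hB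
  have hAφ := congrArg (fun t => t ≫ φ) hA
  simp only [right_comp] at hAφ
  have : (a ≫ x) ≫ φ = smul B.right (a ≫ α.app) (a ≫ y) (app_c_eq α a) := by
    rw [Category.assoc, ← hxφ, comp_smul]
  rw [← Category.assoc]
  exact B.isAct_right.smul_left_cancel _ _ (hAφ.trans (this.trans hB.symm))

end NatTrans

end Bibundle

/-! ### Quotients by equivalence relations -/

section Quotients

variable {𝒞 : Type u} [Category.{v} 𝒞]

/-- The relation between generalized elements of `A` represented by a pair of morphisms. -/
def GenRel {R A : 𝒞} (r₁ r₂ : R ⟶ A) {T : 𝒞} (x y : T ⟶ A) : Prop :=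
  ∃ t : T ⟶ R, t ≫ r₁ = x ∧ t ≫ r₂ = y

lemma isEquivalenceRelation_of_genRel [HasPullbacks 𝒞] {R A : 𝒞} {r₁ r₂ : R ⟶ A}
    (hm : JointlyMono₂ r₁ r₂) (h : ∀ T : 𝒞, Equivalence (GenRel (T := T) r₁ r₂)) :
    IsEquivalenceRelation r₁ r₂ := by
  obtain ⟨r, hr₁, hr₂⟩ := (h A).refl (𝟙 A)
  obtain ⟨s, hs₁, hs₂⟩ := (h R).symm (⟨𝟙 R, Category.id_comp _, Category.id_comp _⟩ :
    GenRel r₁ r₂ r₁ r₂)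
  have h₁ : GenRel r₁ r₂ (pullback.fst r₂ r₁ ≫ r₁) (pullback.fst r₂ r₁ ≫ r₂) := ⟨_, rfl, rfl⟩
  have h₂ : GenRel r₁ r₂ (pullback.fst r₂ r₁ ≫ r₂) (pullback.snd r₂ r₁ ≫ r₂) :=
    ⟨pullback.snd r₂ r₁, pullback.condition.symm, rfl⟩
  obtain ⟨t, ht₁, ht₂⟩ := (h _).trans h₁ h₂
  exact ⟨⟨{ toJointlyMono₂ := hm
            r := r
            reflexivity₁ := hr₁
            reflexivity₂ := hr₂
            s := s
            symmetry₁ := hs₁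
            symmetry₂ := hs₂
            c := pullback.cone r₂ r₁
            isLimit := pullback.isLimit r₂ r₁
            t := t
            transitivity₁ := ht₁
            transitivity₂ := ht₂ }⟩⟩

lemma exists_quotient [HasZeroMorphisms 𝒞] [SemiAbelian 𝒞] {R A : 𝒞} {r₁ r₂ : R ⟶ A}
    (hm : JointlyMono₂ r₁ r₂) (h : ∀ T : 𝒞, Equivalence (GenRel (T := T) r₁ r₂)) :
    ∃ (E : 𝒞) (π : A ⟶ E), IsRegularEpi π ∧
      ∀ ⦃T : 𝒞⦄ (x y : T ⟶ A), x ≫ π = y ≫ π ↔ GenRel r₁ r₂ x y := by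
  obtain ⟨Y, f, hf⟩ := SemiAbelian.effective r₁ r₂ (isEquivalenceRelation_of_genRel hm h)
  -- the quotient is the regular image of a morphism with kernel pair `R`
  let I := Regular.strongEpiMonoFactorisation f
  have hI : I.e ≫ I.m = f := I.fac
  refine ⟨I.I, I.e, by dsimp only [I]; infer_instance, fun T x y => ?_⟩
  rw [← cancel_mono I.m, Category.assoc, Category.assoc, hI]
  constructor
  · intro hxy
    exact ⟨hf.lift x y hxy, hf.lift_fst _ _ _, hf.lift_snd _ _ _⟩
  · rintro ⟨t, rfl, rfl⟩
    rw [Category.assoc, Category.assoc, hf.w]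

end Quotients

/-! ### The bibundle of a functor -/

section FunctorBibundle

variable {𝒞 : Type u} [Category.{v} 𝒞] [HasZeroMorphisms 𝒞] [SemiAbelian 𝒞]
  {C D X : IntGroupoid 𝒞}

namespace IntFunctor

section Cograph

variable (F : IntFunctor X D) {T : 𝒞}

/-- The pairs `(δ, a)` of an object `a` of `X` and an arrow `δ` of `D` with codomain `F a`. -/
noncomputable abbrev cograph : 𝒞 := pullback D.c F.obj

/-- The generalized element `(δ, a)`. -/
noncomputable abbrev mkCograph (δ : T ⟶ D.arr) (a : T ⟶ X.obj) (h : δ ≫ D.c = a ≫ F.obj) :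
    T ⟶ F.cograph :=
  pullback.lift δ a h

/-- The arrow of a pair. -/
noncomputable abbrev cographArr : F.cograph ⟶ D.arr := pullback.fst D.c F.obj

/-- The object of a pair. -/
noncomputable abbrev cographObj : F.cograph ⟶ X.obj := pullback.snd D.c F.obj

lemma cograph_ext {p q : T ⟶ F.cograph} (h₁ : p ≫ F.cographArr = q ≫ F.cographArr)
    (h₂ : p ≫ F.cographObj = q ≫ F.cographObj) : p = q :=
  pullback.hom_ext h₁ h₂

lemma move_condition (p : T ⟶ F.cograph) (f : T ⟶ X.arr) (h : f ≫ X.d = p ≫ F.cographObj) :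
    (p ≫ F.cographArr) ≫ D.c = (f ≫ F.arr) ≫ D.d := by
  rw [Category.assoc, pullback.condition, Category.assoc, F.w_d, ← Category.assoc f, h,
    Category.assoc]

/-- The right action of the arrows of `X` on pairs: `f : a ⟶ b` carries `(δ, a)` to
`(δ ≫ F f, b)`. -/
noncomputable def move (p : T ⟶ F.cograph) (f : T ⟶ X.arr) (h : f ≫ X.d = p ≫ F.cographObj) :
    T ⟶ F.cograph :=
  F.mkCograph (D.comp (p ≫ F.cographArr) (f ≫ F.arr) (F.move_condition p f h)) (f ≫ X.c)
    (by rw [D.comp_c, Category.assoc, F.w_c, Category.assoc])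

variable (p : T ⟶ F.cograph) (f : T ⟶ X.arr) (h : f ≫ X.d = p ≫ F.cographObj)

lemma move_arr : F.move p f h ≫ F.cographArr =
    D.comp (p ≫ F.cographArr) (f ≫ F.arr) (F.move_condition p f h) :=
  pullback.lift_fst _ _ _

lemma move_obj : F.move p f h ≫ F.cographObj = f ≫ X.c :=
  pullback.lift_snd _ _ _

lemma comp_move {T' : 𝒞} (t : T' ⟶ T) :
    t ≫ F.move p f h = F.move (t ≫ p) (t ≫ f) (by rw [Category.assoc, h, Category.assoc]) := by
  apply F.cograph_ext
  · rw [Category.assoc, move_arr, D.precomp, move_arr]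
    exact D.comp_congr (Category.assoc _ _ _).symm (Category.assoc _ _ _).symm _
  · rw [Category.assoc, move_obj, move_obj, Category.assoc]

variable {p f} in
lemma move_congr {p' : T ⟶ F.cograph} {f' : T ⟶ X.arr} (hp : p = p') (hf : f = f') :
    F.move p f h = F.move p' f' (by rw [← hp, ← hf, h]) := by
  subst hp hf
  rfl

lemma move_move (g : T ⟶ X.arr) (hfg : f ≫ X.c = g ≫ X.d) :
    F.move (F.move p f h) g (by rw [move_obj, hfg]) =
      F.move p (X.comp f g hfg) (by rw [X.comp_d, h]) := by
  apply F.cograph_ext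
  · refine (F.move_arr _ _ _).trans (Eq.trans ?_ (F.move_arr _ _ _).symm)
    refine (D.comp_congr (F.move_arr p f h) rfl _).trans ?_
    refine (D.comp_assoc _ _ _ (F.move_condition p f h) (F.condition hfg)).trans ?_
    exact D.comp_congr rfl (F.map_comp f g hfg).symm _
  · rw [move_obj, move_obj, X.comp_c]

variable {p f} in
lemma move_id (hf : f = p ≫ F.cographObj ≫ X.e) : F.move p f h = p := by
  have he : f ≫ F.arr = ((p ≫ F.cographObj) ≫ F.obj) ≫ D.e := by
    rw [hf]
    simp only [Category.assoc, F.w_e]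
  apply F.cograph_ext
  · rw [move_arr, D.comp_congr rfl he, D.comp_id]
  · rw [move_obj, hf]
    simp [X.e_c]

/-- The left action of the arrows of `D` on pairs. -/
noncomputable def premul (δ : T ⟶ D.arr) (p : T ⟶ F.cograph)
    (h : δ ≫ D.c = (p ≫ F.cographArr) ≫ D.d) : T ⟶ F.cograph :=
  F.mkCograph (D.comp δ (p ≫ F.cographArr) h) (p ≫ F.cographObj)
    (by rw [D.comp_c, Category.assoc, pullback.condition, Category.assoc])

variable (δ : T ⟶ D.arr)

lemma premul_arr (h : δ ≫ D.c = (p ≫ F.cographArr) ≫ D.d) :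
    F.premul δ p h ≫ F.cographArr = D.comp δ (p ≫ F.cographArr) h :=
  pullback.lift_fst _ _ _

lemma premul_obj (h : δ ≫ D.c = (p ≫ F.cographArr) ≫ D.d) :
    F.premul δ p h ≫ F.cographObj = p ≫ F.cographObj :=
  pullback.lift_snd _ _ _

lemma comp_premul {T' : 𝒞} (t : T' ⟶ T) (h : δ ≫ D.c = (p ≫ F.cographArr) ≫ D.d) :
    t ≫ F.premul δ p h = F.premul (t ≫ δ) (t ≫ p)
      (by rw [Category.assoc, h]; simp only [Category.assoc]) := by
  apply F.cograph_ext
  · rw [Category.assoc, premul_arr, D.precomp, premul_arr]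
    exact D.comp_congr rfl (Category.assoc _ _ _).symm _
  · rw [Category.assoc, premul_obj, premul_obj, Category.assoc]

variable {p δ} in
lemma premul_congr {p' : T ⟶ F.cograph} {δ' : T ⟶ D.arr} (hδ : δ = δ') (hp : p = p')
    (h : δ ≫ D.c = (p ≫ F.cographArr) ≫ D.d) :
    F.premul δ p h = F.premul δ' p' (by rw [← hp, ← hδ, h]) := by
  subst hp hδ
  rfl

lemma premul_move (hδ : δ ≫ D.c = (p ≫ F.cographArr) ≫ D.d) :
    F.premul δ (F.move p f h) (by rw [move_arr, D.comp_d, hδ]) =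
      F.move (F.premul δ p hδ) f (by rw [premul_obj, h]) := by
  apply F.cograph_ext
  · refine (F.premul_arr _ _ _).trans (Eq.trans ?_ (F.move_arr _ _ _).symm)
    refine (D.comp_congr rfl (F.move_arr p f h) _).trans ?_
    refine (D.comp_assoc _ _ _ hδ (F.move_condition p f h)).symm.trans ?_
    exact D.comp_congr (F.premul_arr p δ hδ).symm rfl _
  · rw [premul_obj, move_obj, move_obj]

end Cograph

end IntFunctor

namespace IntGroupoid.IsRestriction

variable {S : IntFunctor X C} (hS : C.IsRestriction S.obj X.d X.c S.arr) {T : 𝒞}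

/-- The arrow `a ⟶ b` of `X` over an identity arrow of `C`. -/
noncomputable def vert (a b : T ⟶ X.obj) (h : a ≫ S.obj = b ≫ S.obj) : T ⟶ X.arr :=
  hS.lift a b ((a ≫ S.obj) ≫ C.e) (by simp [C.e_d]) (by simp [C.e_c, h])

variable (a b : T ⟶ X.obj) (h : a ≫ S.obj = b ≫ S.obj)

lemma vert_d : hS.vert a b h ≫ X.d = a := hS.lift_d _ _ _ _ _

lemma vert_c : hS.vert a b h ≫ X.c = b := hS.lift_c _ _ _ _ _

lemma vert_s : hS.vert a b h ≫ S.arr = (a ≫ S.obj) ≫ C.e := hS.lift_s _ _ _ _ _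

lemma comp_vert {T' : 𝒞} (t : T' ⟶ T) : t ≫ hS.vert a b h =
    hS.vert (t ≫ a) (t ≫ b) (by rw [Category.assoc, h, Category.assoc]) := by
  apply hS.hom_ext
  · rw [Category.assoc, vert_d, vert_d]
  · rw [Category.assoc, vert_c, vert_c]
  · rw [Category.assoc, vert_s, vert_s]
    simp only [Category.assoc]

lemma vert_congr {a' b' : T ⟶ X.obj} (ha : a = a') (hb : b = b') :
    hS.vert a b h = hS.vert a' b' (by rw [← ha, ← hb, h]) := by
  subst ha hb
  rfl

lemma vert_self (a : T ⟶ X.obj) : hS.vert a a rfl = a ≫ X.e := by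
  apply hS.hom_ext
  · rw [vert_d, Category.assoc, X.e_d, Category.comp_id]
  · rw [vert_c, Category.assoc, X.e_c, Category.comp_id]
  · rw [vert_s, Category.assoc, Category.assoc, S.w_e]

lemma vert_comp_vert {b c : T ⟶ X.obj} (hab : a ≫ S.obj = b ≫ S.obj)
    (hbc : b ≫ S.obj = c ≫ S.obj) :
    X.comp (hS.vert a b hab) (hS.vert b c hbc) (by rw [vert_c, vert_d]) =
      hS.vert a c (hab.trans hbc) := by
  apply hS.hom_ext
  · rw [X.comp_d, vert_d, vert_d]
  · rw [X.comp_c, vert_c, vert_c]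
  · rw [S.map_comp]
    refine (C.comp_congr (hS.vert_s _ _ _) (hS.vert_s _ _ _) _).trans ?_
    rw [C.id_comp, vert_s, hab]

end IntGroupoid.IsRestriction

namespace IntFunctor

variable (F : IntFunctor X D) {S : IntFunctor X C} (hS : C.IsRestriction S.obj X.d X.c S.arr)

/-- Pairs are equivalent if an arrow of `X` over an identity of `C` carries one to the other. -/
def CographRel {T : 𝒞} (p q : T ⟶ F.cograph) : Prop :=
  ∃ h : (p ≫ F.cographObj) ≫ S.obj = (q ≫ F.cographObj) ≫ S.obj,
    F.move p (hS.vert _ _ h) (hS.vert_d _ _ _) = q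

lemma cographRel_move {T : 𝒞} (p : T ⟶ F.cograph) (b : T ⟶ X.obj)
    (h : (p ≫ F.cographObj) ≫ S.obj = b ≫ S.obj) :
    F.CographRel hS p (F.move p (hS.vert _ b h) (hS.vert_d _ _ _)) := by
  have e : F.move p (hS.vert _ b h) (hS.vert_d _ _ _) ≫ F.cographObj = b := by
    rw [move_obj, hS.vert_c]
  refine ⟨by rw [e, h], ?_⟩
  exact F.move_congr _ rfl (hS.vert_congr _ _ _ rfl e)

lemma equivalence_cographRel (T : 𝒞) : Equivalence (F.CographRel hS (T := T)) where
  refl p := ⟨rfl, F.move_id _ (by rw [hS.vert_self, Category.assoc])⟩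
  symm {p q} := by
    rintro ⟨h, hq⟩
    refine ⟨h.symm, ?_⟩
    have e : (hS.vert _ _ h) ≫ X.c = (hS.vert _ _ h.symm) ≫ X.d := by
      rw [hS.vert_c, hS.vert_d]
    rw [F.move_congr _ hq.symm rfl, F.move_move _ _ _ _ e]
    exact F.move_id _ (by rw [hS.vert_comp_vert, hS.vert_self, Category.assoc])
  trans {p q r} := by
    rintro ⟨h, hq⟩ ⟨h', hr⟩
    refine ⟨h.trans h', ?_⟩
    have e : (hS.vert _ _ h) ≫ X.c = (hS.vert _ _ h') ≫ X.d := by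
      rw [hS.vert_c, hS.vert_d]
    refine Eq.trans ?_ hr
    rw [F.move_congr _ hq.symm rfl, F.move_move _ _ _ _ e]
    exact F.move_congr _ rfl (hS.vert_comp_vert _ _ _).symm

lemma exists_cograph_quotient : ∃ (E : 𝒞) (π : F.cograph ⟶ E), IsRegularEpi π ∧
    ∀ ⦃T : 𝒞⦄ (p q : T ⟶ F.cograph), p ≫ π = q ≫ π ↔ F.CographRel hS p q := by
  let r₁ := pullback.fst (F.cographObj ≫ S.obj) S.obj
  let b := pullback.snd (F.cographObj ≫ S.obj) S.obj
  have hb : (r₁ ≫ F.cographObj) ≫ S.obj = b ≫ S.obj := by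
    rw [Category.assoc]
    exact pullback.condition
  let r₂ := F.move r₁ (hS.vert _ b hb) (hS.vert_d _ _ _)
  have hr₂ : r₂ ≫ F.cographObj = b := by rw [move_obj, hS.vert_c]
  have hrel : ∀ {T : 𝒞} (p q : T ⟶ F.cograph), GenRel r₁ r₂ p q ↔ F.CographRel hS p q := by
    intro T p q
    constructor
    · rintro ⟨t, rfl, rfl⟩
      obtain ⟨h, hr⟩ := F.cographRel_move hS r₁ b hb
      refine ⟨?_, ?_⟩
      · rw [Category.assoc t r₂, hr₂]
        simp only [Category.assoc] at hb ⊢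
        rw [hb]
      · change _ = t ≫ F.move r₁ (hS.vert _ b hb) (hS.vert_d _ _ _)
        refine Eq.trans ?_ (F.comp_move _ _ _ t).symm
        refine F.move_congr _ rfl ?_
        rw [hS.comp_vert]
        exact hS.vert_congr _ _ _ (Category.assoc _ _ _) (by rw [Category.assoc, hr₂])
    · rintro ⟨h, hq⟩
      refine ⟨pullback.lift p (q ≫ F.cographObj) (by rw [← Category.assoc, h]),
        pullback.lift_fst _ _ _, Eq.trans ?_ hq⟩
      change _ ≫ F.move r₁ (hS.vert _ b hb) (hS.vert_d _ _ _) = _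
      rw [comp_move]
      refine F.move_congr _ (pullback.lift_fst _ _ _) ?_
      rw [hS.comp_vert]
      refine hS.vert_congr _ _ _ ?_ ?_
      · rw [← Category.assoc, pullback.lift_fst]
      · rw [pullback.lift_snd]
  have hm : JointlyMono₂ r₁ r₂ := ⟨fun T s t h₁ h₂ => by
    apply pullback.hom_ext h₁
    have := congrArg (fun u => u ≫ F.cographObj) h₂
    simpa only [Category.assoc, hr₂] using this⟩
  obtain ⟨E, π, hπ, h⟩ := exists_quotient hm fun T => by
    have e : (GenRel r₁ r₂ : (T ⟶ _) → (T ⟶ _) → Prop) = F.CographRel hS := by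
      ext p q
      exact hrel p q
    rw [e]
    exact F.equivalence_cographRel hS T
  exact ⟨E, π, hπ, fun T p q => (h p q).trans (hrel p q)⟩

end IntFunctor

end FunctorBibundle

section FunctorBibundle

variable {𝒞 : Type u} [Category.{v} 𝒞] [HasZeroMorphisms 𝒞] [SemiAbelian 𝒞]
  {C D X : IntGroupoid 𝒞}

namespace IntFunctor

section Quotient

variable (F : IntFunctor X D) {S : IntFunctor X C} (hS : C.IsRestriction S.obj X.d X.c S.arr)
  {E : 𝒞} {π : F.cograph ⟶ E}
  (hπ : ∀ ⦃T : 𝒞⦄ (p q : T ⟶ F.cograph), p ≫ π = q ≫ π ↔ F.CographRel hS p q)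
  {σ : E ⟶ C.obj} (hσ : π ≫ σ = F.cographObj ≫ S.obj)
  {ρ : E ⟶ D.obj} (hρ : π ≫ ρ = F.cographArr ≫ D.d)

include hρ in
lemma premul_condition {T : 𝒞} {δ : T ⟶ D.arr} {p : T ⟶ F.cograph} {x : T ⟶ E} (hx : p ≫ π = x)
    (h : δ ≫ D.c = x ≫ ρ) : δ ≫ D.c = (p ≫ F.cographArr) ≫ D.d := by
  rw [h, ← hx, Category.assoc, hρ, Category.assoc]

include hπ in
/-- The left action of `D` on pairs descends to the quotient. -/
lemma exists_right [IsRegularEpi π] : ∃ m : pullback D.c ρ ⟶ E,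
    ∀ ⦃T : 𝒞⦄ (δ : T ⟶ D.arr) (p : T ⟶ F.cograph)
    (h : δ ≫ D.c = (p ≫ π) ≫ ρ), smul m δ (p ≫ π) h =
      F.premul δ p (F.premul_condition hρ rfl h) ≫ π := by
  let f : pullback (pullback.snd D.c ρ) π ⟶ pullback D.c ρ := pullback.fst _ _
  let p₀ : pullback (pullback.snd D.c ρ) π ⟶ F.cograph := pullback.snd _ _
  have hp : p₀ ≫ π = f ≫ pullback.snd D.c ρ := pullback.condition.symm
  have hcond : (f ≫ pullback.fst D.c ρ) ≫ D.c = (p₀ ≫ F.cographArr) ≫ D.d :=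
    F.premul_condition hρ hp (by rw [Category.assoc, pullback.condition, Category.assoc])
  obtain ⟨m, hm⟩ := exists_desc_of_isRegularEpi f
    (F.premul (f ≫ pullback.fst D.c ρ) p₀ hcond ≫ π) fun T s t hst => by
      have hpp : (s ≫ p₀) ≫ π = (t ≫ p₀) ≫ π := by
        rw [Category.assoc, hp, ← Category.assoc, hst, Category.assoc, ← hp, Category.assoc]
      obtain ⟨h, ht⟩ := (hπ _ _).1 hpp
      have hs : (s ≫ f ≫ pullback.fst D.c ρ) ≫ D.c = ((s ≫ p₀) ≫ F.cographArr) ≫ D.d := by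
        rw [Category.assoc, hcond]
        simp only [Category.assoc]
      rw [← Category.assoc, ← Category.assoc, F.comp_premul, F.comp_premul]
      rw [F.premul_congr (show t ≫ f ≫ pullback.fst D.c ρ = s ≫ f ≫ pullback.fst D.c ρ by
        rw [← Category.assoc, ← hst, Category.assoc]) ht.symm]
      refine Eq.trans ?_ (congrArg (fun u => u ≫ π) (F.premul_move _ _ _ _ hs).symm)
      have e := F.premul_obj (s ≫ p₀) _ hs
      refine ((hπ _ _).2 (F.cographRel_move hS _ ((t ≫ p₀) ≫ F.cographObj)
        (by rw [e]; exact h))).trans ?_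
      exact congrArg (fun u => u ≫ π) (F.move_congr _ rfl (hS.vert_congr _ _ _ e rfl))
  refine ⟨m, fun T δ p h => ?_⟩
  have hl : pullback.lift δ (p ≫ π) h ≫ pullback.snd D.c ρ = p ≫ π := pullback.lift_snd _ _ _
  let t : T ⟶ pullback (pullback.snd D.c ρ) π := pullback.lift (pullback.lift δ (p ≫ π) h) p hl
  have htf : t ≫ f = pullback.lift δ (p ≫ π) h := pullback.lift_fst _ _ _
  have htp : t ≫ p₀ = p := pullback.lift_snd _ _ _
  have := congrArg (fun u => t ≫ u) hm
  change t ≫ f ≫ m = t ≫ F.premul (f ≫ pullback.fst D.c ρ) p₀ hcond ≫ π at this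
  rw [← Category.assoc, htf, ← Category.assoc, F.comp_premul] at this
  refine this.trans (congrArg (fun u => u ≫ π) (F.premul_congr ?_ htp _))
  rw [← Category.assoc, htf, pullback.lift_fst]

include hσ in
lemma left_lift_condition {T : 𝒞} {f : T ⟶ C.arr} {p : T ⟶ F.cograph} {x : T ⟶ E}
    (hx : p ≫ π = x) (h : f ≫ C.c = x ≫ σ) :
    (f ≫ C.i) ≫ C.d = (p ≫ F.cographObj) ≫ S.obj := by
  rw [Category.assoc, C.i_d, h, ← hx, Category.assoc, hσ, Category.assoc]

include hπ hσ in
/-- The action of `C` on the quotient: `f • [p]` is the class of `p` moved along any arrow of `X`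
over the inverse of `f`. -/
lemma exists_left [IsRegularEpi π] [IsRegularEpi S.obj] : ∃ m : pullback C.c σ ⟶ E,
    ∀ ⦃T : 𝒞⦄ (f : T ⟶ C.arr) (p : T ⟶ F.cograph) (h : f ≫ C.c = (p ≫ π) ≫ σ) (t : T ⟶ X.arr)
      (ht : t ≫ X.d = p ≫ F.cographObj) (_ : t ≫ S.arr = f ≫ C.i),
      smul m f (p ≫ π) h = F.move p t ht ≫ π := by
  let r : pullback (pullback.fst C.c σ ≫ C.d) S.obj ⟶ pullback C.c σ := pullback.fst _ _
  let a' : pullback (pullback.fst C.c σ ≫ C.d) S.obj ⟶ X.obj := pullback.snd _ _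
  let w : pullback (r ≫ pullback.snd C.c σ) π ⟶ pullback (pullback.fst C.c σ ≫ C.d) S.obj :=
    pullback.fst _ _
  let p₀ : pullback (r ≫ pullback.snd C.c σ) π ⟶ F.cograph := pullback.snd _ _
  have hw : p₀ ≫ π = w ≫ r ≫ pullback.snd C.c σ := pullback.condition.symm
  let f₀ := w ≫ r ≫ pullback.fst C.c σ
  let a := w ≫ a'
  have ha : a ≫ S.obj = f₀ ≫ C.d := by
    have : a' ≫ S.obj = r ≫ pullback.fst C.c σ ≫ C.d := pullback.condition.symm
    simp only [a, f₀, Category.assoc, this]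
  have hf₀ : (f₀ ≫ C.i) ≫ C.d = (p₀ ≫ F.cographObj) ≫ S.obj :=
    F.left_lift_condition hσ hw (by simp only [f₀, Category.assoc, pullback.condition])
  let t₀ := hS.lift (p₀ ≫ F.cographObj) a (f₀ ≫ C.i) hf₀
    (by rw [Category.assoc, C.i_c, ha])
  have t₀d : t₀ ≫ X.d = p₀ ≫ F.cographObj := hS.lift_d _ _ _ _ _
  have t₀c : t₀ ≫ X.c = a := hS.lift_c _ _ _ _ _
  have t₀s : t₀ ≫ S.arr = f₀ ≫ C.i := hS.lift_s _ _ _ _ _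
  -- the class does not depend on the representative and on the arrow
  have key : ∀ {T : 𝒞} (p q : T ⟶ F.cograph) (s t : T ⟶ X.arr) (hs : s ≫ X.d = p ≫ F.cographObj)
      (ht : t ≫ X.d = q ≫ F.cographObj), p ≫ π = q ≫ π → s ≫ S.arr = t ≫ S.arr →
        F.move p s hs ≫ π = F.move q t ht ≫ π := by
    intro T p q s t hs ht hpq hst
    obtain ⟨h, hq⟩ := (hπ _ _).1 hpq
    have hc : (s ≫ X.c) ≫ S.obj = (t ≫ X.c) ≫ S.obj := by
      rw [Category.assoc, ← S.w_c, ← Category.assoc, hst, Category.assoc, S.w_c, Category.assoc]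
    have hv : hS.vert _ _ h ≫ X.c = t ≫ X.d := by rw [hS.vert_c, ht]
    have hv' : s ≫ X.c = hS.vert _ _ hc ≫ X.d := by rw [hS.vert_d]
    have e : X.comp s (hS.vert _ _ hc) hv' = X.comp (hS.vert _ _ h) t hv := by
      apply hS.hom_ext
      · rw [X.comp_d, X.comp_d, hS.vert_d, hs]
      · rw [X.comp_c, X.comp_c, hS.vert_c]
      · rw [S.map_comp, S.map_comp]
        refine (C.comp_congr hst (hS.vert_s _ _ _) _).trans ?_
        refine Eq.trans ?_ (C.comp_congr (hS.vert_s _ _ _) rfl _).symm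
        rw [C.id_comp, C.comp_id]
    have hm : (F.move p s hs ≫ F.cographObj) ≫ S.obj = (t ≫ X.c) ≫ S.obj := by
      rw [F.move_obj, hc]
    refine ((hπ _ _).2 (F.cographRel_move hS _ _ hm)).trans (congrArg (fun u => u ≫ π) ?_)
    refine (F.move_congr _ rfl (hS.vert_congr _ _ _ (F.move_obj p s hs) rfl)).trans ?_
    rw [F.move_move _ _ _ _ hv']
    refine Eq.trans ?_ (F.move_congr (by rw [F.move_obj, hv]) hq rfl)
    rw [F.move_move _ _ _ _ hv]
    exact F.move_congr _ rfl e
  have hwr : IsRegularEpi (w ≫ r) := by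
    have : IsRegularEpi w := by dsimp only [w]; infer_instance
    have : IsRegularEpi r := by dsimp only [r]; infer_instance
    infer_instance
  obtain ⟨m, hm⟩ := exists_desc_of_isRegularEpi (w ≫ r) (F.move p₀ t₀ t₀d ≫ π)
    fun T u v huv => by
      rw [← Category.assoc, ← Category.assoc, F.comp_move, F.comp_move]
      apply key
      · rw [Category.assoc, hw, Category.assoc, hw]
        simp only [← Category.assoc] at huv ⊢
        rw [huv]
      · rw [Category.assoc u t₀, t₀s, Category.assoc v t₀, t₀s]
        simp only [f₀, ← Category.assoc] at huv ⊢
        rw [huv]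
  refine ⟨m, fun T f p h t ht hts => ?_⟩
  have hc : f ≫ C.d = (t ≫ X.c) ≫ S.obj := by
    rw [Category.assoc, ← S.w_c, ← Category.assoc, hts, Category.assoc, C.i_c]
  let z : T ⟶ pullback (pullback.fst C.c σ ≫ C.d) S.obj :=
    pullback.lift (pullback.lift f (p ≫ π) h) (t ≫ X.c)
      (by rw [← Category.assoc, pullback.lift_fst, hc])
  have hzr : z ≫ r = pullback.lift f (p ≫ π) h := pullback.lift_fst _ _ _
  let y : T ⟶ pullback (r ≫ pullback.snd C.c σ) π := pullback.lift z p
    (by rw [← Category.assoc, hzr, pullback.lift_snd])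
  have hyw : y ≫ w = z := pullback.lift_fst _ _ _
  have hyp : y ≫ p₀ = p := pullback.lift_snd _ _ _
  have := congrArg (fun u => y ≫ u) hm
  change y ≫ (w ≫ r) ≫ m = y ≫ F.move p₀ t₀ t₀d ≫ π at this
  rw [← Category.assoc, ← Category.assoc, hyw, hzr, ← Category.assoc, F.comp_move] at this
  refine this.trans (key _ _ _ _ _ _ (by rw [hyp]) ?_)
  rw [Category.assoc, t₀s, hts]
  simp only [f₀, ← Category.assoc]
  rw [hyw, hzr, pullback.lift_fst]

end Quotient

/-- Every functor from `X` to `D` is represented by a bibundle, the quotient of the pairs `(δ, a)`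
by the arrows of `X` over identities of `C`, with the lift `a ↦ [1, a]`. -/
theorem exists_toFunctor_eq (F : IntFunctor X D) {S : IntFunctor X C}
    (hS : C.IsRestriction S.obj X.d X.c S.arr) [IsRegularEpi S.obj] :
    ∃ (B : Bibundle C D) (x : X.obj ⟶ B.E) (hx : x ≫ B.σ = S.obj), B.toFunctor S x hx = F := by
  obtain ⟨E, π, _, hπ⟩ := F.exists_cograph_quotient hS
  obtain ⟨σ, hσ⟩ := exists_desc_of_isRegularEpi π (F.cographObj ≫ S.obj) fun T p q hpq => by
    obtain ⟨h, -⟩ := (hπ _ _).1 hpq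
    simpa only [Category.assoc] using h
  obtain ⟨ρ, hρ⟩ := exists_desc_of_isRegularEpi π (F.cographArr ≫ D.d) fun T p q hpq => by
    obtain ⟨h, hq⟩ := (hπ _ _).1 hpq
    rw [← hq, ← Category.assoc, ← Category.assoc, F.move_arr, D.comp_d]
  obtain ⟨M, hM⟩ := F.exists_right hS hπ hρ
  obtain ⟨L, hL⟩ := F.exists_left hS hπ hσ
  have hzero : (0 : D.ker ⟶ F.cograph) ≫ π = 0 := zero_comp
  -- the value of `M` on the kernel
  have kc : D.kerι ≫ D.c = (0 : D.ker ⟶ X.obj) ≫ F.obj := by rw [D.kerι_c, zero_comp]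
  let ι : D.ker ⟶ E := F.mkCograph D.kerι 0 kc ≫ π
  have hι : smul M D.kerι 0 (by rw [D.kerι_c, zero_comp]) = ι := by
    have h := hM D.kerι 0 (by rw [D.kerι_c, zero_comp, zero_comp])
    rw [smul_congr M rfl hzero] at h
    refine h.trans (congrArg (fun u => u ≫ π) ?_)
    apply F.cograph_ext
    · rw [F.premul_arr, pullback.lift_fst]
      exact (D.comp_congr rfl zero_comp _).trans (D.comp_zero _ _)
    · rw [F.premul_obj, pullback.lift_snd, zero_comp]
  have ι_ρ : ι ≫ ρ = D.kerι ≫ D.d := by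
    rw [Category.assoc, hρ, ← Category.assoc, pullback.lift_fst]
  have ι_σ : ι ≫ σ = 0 := by
    rw [Category.assoc, hσ, ← Category.assoc, pullback.lift_snd, zero_comp]
  have isAct_M : IsAct D ρ ι M := by
    refine ⟨ι_ρ, ?_, hι⟩
    refine (cancel_epi π).1 ((comp_smul _ _ _ _ _).trans ?_)
    have h := hM (π ≫ ρ ≫ D.e) (𝟙 _) (by simp [D.e_c])
    refine (smul_congr M rfl (by rw [Category.id_comp, Category.comp_id]) _).trans (h.trans ?_)
    refine Eq.trans ?_ ((Category.id_comp π).trans (Category.comp_id π).symm)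
    refine congrArg (fun u => u ≫ π) (F.cograph_ext ?_ ?_)
    · rw [F.premul_arr]
      refine (D.comp_congr (Category.assoc _ _ _).symm rfl _).trans (D.id_comp _ _ ?_)
      rw [Category.assoc, D.e_c, Category.comp_id, hρ, Category.id_comp]
    · rw [F.premul_obj]
  -- the value of `L` on the kernel
  obtain ⟨κ, hκ⟩ : ∃ κ, κ = smul L C.kerι 0 (by rw [C.kerι_c, zero_comp]) := ⟨_, rfl⟩
  obtain ⟨T, q, a, hq, ha⟩ := exists_cover S.obj (C.kerι ≫ C.d)
  have hz : (0 : T ⟶ F.cograph) ≫ F.cographObj = 0 := zero_comp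
  let t : T ⟶ X.arr := hS.lift 0 a (q ≫ C.kerι ≫ C.i)
    (by simp only [Category.assoc, C.i_d, C.kerι_c, comp_zero, zero_comp])
    (by simp only [Category.assoc, C.i_c, ha])
  have td : t ≫ X.d = (0 : T ⟶ F.cograph) ≫ F.cographObj := (hS.lift_d _ _ _ _ _).trans hz.symm
  have tc : t ≫ X.c = a := hS.lift_c _ _ _ _ _
  have ts : t ≫ S.arr = (q ≫ C.kerι) ≫ C.i :=
    (hS.lift_s _ _ _ _ _).trans (Category.assoc _ _ _).symm
  have hqκ : q ≫ κ = F.move 0 t td ≫ π := by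
    rw [hκ, comp_smul]
    refine Eq.trans ?_ (hL (q ≫ C.kerι) 0 (by
      rw [Category.assoc, C.kerι_c, comp_zero, zero_comp, zero_comp]) t td ts)
    exact smul_congr L rfl (by rw [comp_zero, zero_comp]) _
  have κ_σ : κ ≫ σ = C.kerι ≫ C.d := by
    rw [← cancel_epi q, ← Category.assoc, hqκ, Category.assoc, hσ, ← Category.assoc, F.move_obj,
      tc, ha]
  have κ_ρ : κ ≫ ρ = 0 := by
    rw [← cancel_epi q, ← Category.assoc, hqκ, Category.assoc, hρ, ← Category.assoc, F.move_arr,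
      D.comp_d, zero_comp, zero_comp, comp_zero]
  have isAct_L : IsAct C σ κ L := by
    refine ⟨κ_σ, ?_, hκ.symm⟩
    refine (cancel_epi π).1 ((comp_smul _ _ _ _ _).trans ?_)
    have h := hL (π ≫ σ ≫ C.e) (𝟙 _) (by simp [C.e_c]) (F.cographObj ≫ X.e)
      (by simp [X.e_d]) (by
        rw [Category.assoc, S.w_e, ← Category.assoc, ← hσ]
        simp only [Category.assoc, C.e_i])
    refine (smul_congr L rfl (by rw [Category.id_comp, Category.comp_id]) _).trans (h.trans ?_)
    rw [F.move_id _ (Category.id_comp _).symm, Category.id_comp, Category.comp_id]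
  -- the relation identifies no two elements of the kernel
  have ι_mono : Mono ι := ⟨fun {Z} g g' h => by
    rw [← Category.assoc, ← Category.assoc] at h
    obtain ⟨h₀, h'⟩ := (hπ _ _).1 h
    have e : ∀ u : Z ⟶ D.ker, (u ≫ F.mkCograph D.kerι 0 kc) ≫ F.cographObj = 0 := by
      intro u
      rw [Category.assoc, pullback.lift_snd, comp_zero]
    have := congrArg (fun u => u ≫ F.cographArr) ((F.move_id _
      ((hS.vert_congr _ _ h₀ rfl ((e g').trans (e g).symm)).trans
        ((hS.vert_self _).trans (Category.assoc _ _ _)))).symm.trans h')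
    simpa only [Category.assoc, pullback.lift_fst, cancel_mono] using this⟩
  have isKernel : Nonempty (IsLimit (KernelFork.ofι ι ι_σ)) := by
    refine nonempty_isLimit_kernelFork ι_σ fun T x hx => ?_
    obtain ⟨T', r, p, hr, hp⟩ := exists_cover π x
    have hp₀ : (p ≫ F.cographObj) ≫ S.obj = (0 : T' ⟶ X.obj) ≫ S.obj := by
      rw [Category.assoc, ← hσ, ← Category.assoc, hp, Category.assoc, hx, comp_zero, zero_comp]
    let p' := F.move p (hS.vert _ _ hp₀) (hS.vert_d _ _ _)
    have hpp : p ≫ π = p' ≫ π := (hπ _ _).2 (F.cographRel_move hS p 0 hp₀)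
    have hp'₀ : p' ≫ F.cographObj = 0 := by rw [F.move_obj, hS.vert_c]
    obtain ⟨k, hk⟩ := D.exists_lift_kerι (p' ≫ F.cographArr) (by
      rw [Category.assoc, pullback.condition, ← Category.assoc, hp'₀, zero_comp])
    have hkι : k ≫ ι = r ≫ x := by
      rw [← hp, hpp, ← Category.assoc]
      refine congrArg (fun u => u ≫ π) (F.cograph_ext ?_ ?_)
      · rw [Category.assoc, pullback.lift_fst, hk]
      · rw [Category.assoc, pullback.lift_snd, hp'₀, comp_zero]
    obtain ⟨u, hu⟩ := exists_desc_of_isRegularEpi r k fun T'' s s' hss => by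
      rw [← cancel_mono ι, Category.assoc, hkι, Category.assoc, hkι, ← Category.assoc, hss,
        Category.assoc]
    refine ⟨u, ?_⟩
    rw [← cancel_epi r, ← Category.assoc, hu, hkι]
  have one_c : (F.obj ≫ D.e) ≫ D.c = 𝟙 _ ≫ F.obj := by simp [D.e_c]
  let s := F.mkCograph (F.obj ≫ D.e) (𝟙 _) one_c
  have s_obj : s ≫ F.cographObj = 𝟙 _ := pullback.lift_snd _ _ _
  have s_arr : s ≫ F.cographArr = F.obj ≫ D.e := pullback.lift_fst _ _ _
  have regσ : IsRegularEpi σ := by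
    have : IsSplitEpi F.cographObj := IsSplitEpi.mk' ⟨s, s_obj⟩
    have : IsRegularEpi (π ≫ σ) := by rw [hσ]; infer_instance
    exact isRegularEpi_of_isRegularEpi_comp π σ
  let B : Bibundle C D := ⟨E, σ, ρ, κ, ι, L, M, isAct_L, isAct_M, κ_ρ, ι_σ, isKernel, regσ⟩
  have hx : (s ≫ π) ≫ B.σ = S.obj := by
    change (s ≫ π) ≫ σ = S.obj
    rw [Category.assoc, hσ, ← Category.assoc, s_obj, Category.id_comp]
  have hobj : (s ≫ π) ≫ ρ = F.obj := by
    rw [Category.assoc, hρ, ← Category.assoc, s_arr, Category.assoc, D.e_d, Category.comp_id]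
  have harr : B.functorArr S (s ≫ π) hx = F.arr := by
    symm
    have hc : F.arr ≫ D.c = (X.c ≫ s ≫ π) ≫ ρ := by rw [Category.assoc, hobj, F.w_c]
    have hSc : S.arr ≫ C.c = (X.c ≫ s ≫ π) ≫ σ := by
      rw [S.w_c, Category.assoc]
      exact congrArg (fun u => X.c ≫ u) hx.symm
    let t : X.arr ⟶ X.arr := hS.lift X.c X.d (S.arr ≫ C.i)
      (by rw [Category.assoc, C.i_d, S.w_c]) (by rw [Category.assoc, C.i_c, S.w_d])
    have td : t ≫ X.d = (X.c ≫ s) ≫ F.cographObj := by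
      rw [Category.assoc, s_obj, Category.comp_id]
      exact hS.lift_d _ _ _ _ _
    have tc : t ≫ X.c = X.d := hS.lift_c _ _ _ _ _
    have ts : t ≫ S.arr = S.arr ≫ C.i := hS.lift_s _ _ _ _ _
    have h₁ : smul L S.arr (X.c ≫ s ≫ π) hSc = F.move (X.c ≫ s) t td ≫ π := by
      refine Eq.trans ?_ (hL S.arr (X.c ≫ s) (by rw [hSc]; simp only [Category.assoc]) t td ts)
      exact smul_congr L rfl (Category.assoc _ _ _).symm _
    have h₂ : F.arr ≫ D.c = (F.move (X.c ≫ s) t td ≫ π) ≫ ρ := by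
      rw [← h₁, isAct_L.smul_comp_eq κ_ρ, hc]
    refine B.eq_div _ (by rw [B.isAct_left.smul_comp_eq B.κ_ρ]; exact hc) ?_
    refine (smul_congr M rfl h₁ _).trans ((hM F.arr _ h₂).trans ?_)
    rw [← Category.assoc]
    have hXt : 𝟙 X.arr ≫ X.c = t ≫ X.d := by
      rw [Category.id_comp, td, Category.assoc, s_obj, Category.comp_id]
    have e : X.comp (𝟙 X.arr) t hXt = X.d ≫ X.e := by
      apply hS.hom_ext
      · rw [X.comp_d, Category.id_comp, Category.assoc, X.e_d, Category.comp_id]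
      · rw [X.comp_c, tc, Category.assoc, X.e_c, Category.comp_id]
      · rw [S.map_comp]
        refine (C.comp_congr (Category.id_comp _) ts _).trans ?_
        rw [C.comp_inv, Category.assoc, S.w_e, ← Category.assoc, S.w_d, Category.assoc]
    refine congrArg (fun u => u ≫ π) (F.cograph_ext ?_ ?_)
    · rw [F.premul_arr, Category.assoc, s_arr]
      have e₁ : F.move (X.c ≫ s) t td ≫ F.cographArr = t ≫ F.arr := by
        rw [F.move_arr]
        have h₃ : (X.c ≫ s) ≫ F.cographArr = (X.c ≫ F.obj) ≫ D.e := by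
          rw [Category.assoc, s_arr, Category.assoc]
        refine (D.comp_congr h₃ rfl _).trans (D.id_comp _ _ ?_)
        rw [← h₃]
        exact F.move_condition _ _ td
      refine (D.comp_congr (Category.id_comp _).symm e₁ _).trans ?_
      rw [← F.map_comp (𝟙 X.arr) t hXt, e, Category.assoc, F.w_e]
    · rw [F.premul_obj, F.move_obj, tc, Category.assoc, s_obj, Category.comp_id]
  refine ⟨B, s ≫ π, hx, ?_⟩
  have hobj' : (s ≫ π) ≫ B.ρ = F.obj := hobj
  obtain ⟨Fo, Fa, _, _, _, _⟩ := F
  unfold Bibundle.toFunctor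
  congr

end IntFunctor

end FunctorBibundle

/-! ### Butterflies as bibundles -/

section Equivalence

variable {𝒞 : Type u} [Category.{v} 𝒞] [HasZeroMorphisms 𝒞] [SemiAbelian 𝒞]
  {C D X : IntGroupoid 𝒞}

namespace Butterfly

lemma exists_left (B : Butterfly C.J D.J) :
    ∃ m : pullback C.c (B.σ : B.E ⟶ C.obj) ⟶ B.E, IsAct C B.σ B.κ m :=
  exists_isAct B.κ_σ B.κ_act

lemma exists_right (B : Butterfly C.J D.J) :
    ∃ m : pullback D.c (B.ρ : B.E ⟶ D.obj) ⟶ B.E, IsAct D B.ρ B.ι m :=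
  exists_isAct B.ι_ρ B.ι_act

lemma isRegularEpi_σ (B : Butterfly C.J D.J) : IsRegularEpi (B.σ : B.E ⟶ C.obj) := by
  obtain ⟨h⟩ := B.isCokernel
  let _ : NormalEpi (B.σ : B.E ⟶ C.obj) := ⟨_, B.ι, B.ι_σ, h⟩
  infer_instance

/-- The bibundle of a butterfly: the equivariance of the wings `κ` and `ι` amounts to actions of
the two groupoids. -/
noncomputable def toBibundle (B : Butterfly C.J D.J) : Bibundle C D where
  E := B.E
  σ := B.σ
  ρ := B.ρ
  κ := B.κ
  ι := B.ι
  left := B.exists_left.choose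
  right := B.exists_right.choose
  isAct_left := B.exists_left.choose_spec
  isAct_right := B.exists_right.choose_spec
  κ_ρ := B.κ_ρ
  ι_σ := B.ι_σ
  isKernel := B.isKernel
  isRegularEpi := B.isRegularEpi_σ

lemma isHom {A B : Butterfly C.J D.J} (φ : A ⟶ B) :
    Bibundle.IsHom A.toBibundle B.toBibundle (ButterflyHom.f φ) :=
  ⟨ButterflyHom.κ_f φ, ButterflyHom.ι_f φ, ButterflyHom.f_σ φ, ButterflyHom.f_ρ φ⟩

end Butterfly

/-- The butterfly underlying a bibundle. -/
def Bibundle.toButterfly (B : Bibundle C D) : Butterfly C.J D.J where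
  E := B.E
  κ := B.κ
  ι := B.ι
  σ := B.σ
  ρ := B.ρ
  κ_σ := B.isAct_left.k_r
  ι_ρ := B.isAct_right.k_r
  κ_ρ := B.κ_ρ
  ι_σ := B.ι_σ
  isKernel := B.isKernel
  isCokernel := by
    have := B.isRegularEpi
    obtain ⟨hl⟩ := B.isKernel
    have h : ∀ {Z : 𝒞} (g : B.E ⟶ Z), B.ι ≫ g = 0 → ∃ g' : C.obj ⟶ Z, B.σ ≫ g' = g := by
      intro Z g hg
      refine exists_desc_of_kernel B.σ g fun T t ht => ?_
      have hu := hl.fac (KernelFork.ofι t ht) WalkingParallelPair.zero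
      change hl.lift (KernelFork.ofι t ht) ≫ B.ι = t at hu
      rw [← hu, Category.assoc, hg, comp_zero]
    exact ⟨CokernelCofork.IsColimit.ofπ B.σ B.ι_σ (fun g hg => (h g hg).choose)
      (fun g hg => (h g hg).choose_spec)
      (fun g hg m hm => by rw [← cancel_epi B.σ, hm, (h g hg).choose_spec])⟩
  κ_act := B.isAct_left.kerAct_comp
  ι_act := B.isAct_right.kerAct_comp

namespace Butterfly

variable (D) in
/-- The functor from butterflies to internal functors that is represented by a choice of lifts
`x B` of the object morphism of `S` along the legs `σ`. -/
noncomputable def representedFunctor (S : IntFunctor X C)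
    (x : ∀ B : Butterfly C.J D.J, X.obj ⟶ B.toBibundle.E) (hx : ∀ B, x B ≫ B.toBibundle.σ = S.obj) :
    Butterfly C.J D.J ⥤ IntFunctor X D where
  obj B := B.toBibundle.toFunctor S (x B) (hx B)
  map {A B} φ := Bibundle.natTrans (isHom φ) (hx A) (hx B)
  map_id B := IntNatTrans.ext (Bibundle.natTrans_app_id (hx B) (isHom (𝟙 B)))
  map_comp {A B B'} φ ψ := IntNatTrans.ext
    (Bibundle.natTrans_app_comp (hx A) (hx B) (hx B') (isHom φ) (isHom ψ) (isHom (φ ≫ ψ)))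

variable {S : IntFunctor X C} (x : ∀ B : Butterfly C.J D.J, X.obj ⟶ B.toBibundle.E)
  (hx : ∀ B, x B ≫ B.toBibundle.σ = S.obj) [IsRegularEpi S.obj]

lemma representedFunctor_faithful : (representedFunctor D S x hx).Faithful where
  map_injective {A B} φ ψ h := by
    apply ButterflyHom.ext
    refine Bibundle.hom_ext (hx A) (isHom φ) (isHom ψ) ?_
    rw [← B.toBibundle.div_smul (Bibundle.hom_condition (isHom φ) (hx A) (hx B)),
      ← B.toBibundle.div_smul (Bibundle.hom_condition (isHom ψ) (hx A) (hx B))]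
    exact smul_congr _ (congrArg IntNatTrans.app h) rfl _

variable (hS : C.IsRestriction S.obj X.d X.c S.arr)

include hS

lemma representedFunctor_full : (representedFunctor D S x hx).Full where
  map_surjective {A B} α := by
    obtain ⟨φ, hφ, hα⟩ := Bibundle.exists_isHom (A := A.toBibundle) (B := B.toBibundle) (hx := hx A)
      (hy := hx B) hS α
    refine ⟨(show ButterflyHom A B from
      ⟨φ, hφ.κ_comp, hφ.ι_comp, hφ.comp_σ, hφ.comp_ρ⟩), ?_⟩
    apply IntNatTrans.ext
    exact (B.toBibundle.eq_div (Bibundle.hom_condition hφ (hx A) (hx B))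
      (Bibundle.app_c_toFunctor α) hα).symm

lemma representedFunctor_essSurj : (representedFunctor D S x hx).EssSurj where
  mem_essImage F := by
    obtain ⟨B, y, hy, rfl⟩ := F.exists_toFunctor_eq hS
    -- the bibundle of the underlying butterfly may carry different, but equal, actions
    have hid : Bibundle.IsHom B.toButterfly.toBibundle B (𝟙 B.E) :=
      ⟨Category.comp_id _, Category.comp_id _, Category.id_comp _, Category.id_comp _⟩
    let α : (representedFunctor D S x hx).obj B.toButterfly ⟶ B.toFunctor S y hy :=
      Bibundle.natTrans hid (hx B.toButterfly) hy
    have := (IntFunctor.isGroupoid X D).all_isIso α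
    exact ⟨B.toButterfly, ⟨asIso α⟩⟩

end Butterfly

/-- Butterflies are equivalent to internal functors on a restriction `X` of `C` along a regular
epimorphism with regular projective domain; projectivity provides the lifts along the legs `σ`. -/
theorem isGroupoid_and_nonempty_equivalence (S : IntFunctor X C)
    (hS : C.IsRestriction S.obj X.d X.c S.arr) (hreg : IsRegularEpi S.obj)
    (hproj : RegularProjective X.obj) :
    IsGroupoid (Butterfly C.J D.J) ∧ Nonempty (Butterfly C.J D.J ≌ IntFunctor X D) := by
  choose x hx using fun B : Butterfly C.J D.J => hproj B.toBibundle.σ B.isRegularEpi_σ S.obj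
  have := Butterfly.representedFunctor_faithful x hx
  have := Butterfly.representedFunctor_full x hx hS
  have := Butterfly.representedFunctor_essSurj x hx hS
  have : (Butterfly.representedFunctor D S x hx).IsEquivalence := { }
  refine ⟨⟨fun {A B} φ => ?_⟩, ⟨(Butterfly.representedFunctor D S x hx).asEquivalence⟩⟩
  have := (IntFunctor.isGroupoid X D).all_isIso ((Butterfly.representedFunctor D S x hx).map φ)
  exact isIso_of_reflects_iso φ (Butterfly.representedFunctor D S x hx)

end Equivalence

end SemiAb

theorem mainTheorem5 {𝒞 : Type u} [Category.{v} 𝒞] [HasZeroMorphisms 𝒞]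
    [SemiAb.SemiAbelian 𝒞] [SemiAb.HuqSmith 𝒞] [SemiAb.EnoughRegularProjectives 𝒞]
    (C D : SemiAb.IntGroupoid 𝒞) {X₀ X₁ : 𝒞} (s₀ : X₀ ⟶ C.obj) (hs₀ : IsRegularEpi s₀)
    (hX₀ : SemiAb.RegularProjective X₀) (d c : X₁ ⟶ X₀) (s₁ : X₁ ⟶ C.arr)
    (hX : C.IsRestriction s₀ d c s₁) :
    IsGroupoid (SemiAb.Butterfly C.J D.J) ∧
    IsGroupoid (SemiAb.IntFunctor hX.groupoid D) ∧
    Nonempty (SemiAb.Butterfly C.J D.J ≌ SemiAb.IntFunctor hX.groupoid D) := by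
  obtain ⟨h₁, h₂⟩ :=
    SemiAb.isGroupoid_and_nonempty_equivalence (D := D) hX.functor hX hs₀ hX₀
  exact ⟨h₁, SemiAb.IntFunctor.isGroupoid _ _, h₂⟩
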